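/- **Setting.** Let $d,K,Y\ge 1$ and let the time horizon satisfy $T\ge 4K$. *Perturbed context generation:* let $0<\rho\le 1/\sqrt d$, and let $D_\mu$ be a distribution over tuples $(\mu_1,\dots,\mu_K)\in(\mathbb R^d\cup\{\perp\})^K$ ($\mu_a=\perp$ means that arm $a$ is unavailable) such that almost surely at least one arm is available and every available arm has $\|\mu_a\|_2\le 1$. The rounds are independent: in each round $t$ a tuple $(\mu_{a,t})_a$ is drawn from $D_\mu$, and, independently, perturbations $\varepsilon_{a,t}$ with i.i.d. $\mathcal N(0,\rho^2)$ coordinates and reward noises $\eta_{a,t}$, i.i.d. $\mathcal N(0,1)$, are drawn. An available arm has context vector $x_{a,t}=\mu_{a,t}+\varepsilon_{a,t}$, and if arm $a_t$ is chosen, then, with $x_t=x_{a_t,t}$, the reward is $r_t=\theta^\top x_t+\eta_{a_t,t}$, where $\theta\in\mathbb R^d$ is the latent vector. Everything below is for each fixed value of $\theta$, i.e. conditional on $\theta$, and so holds for every prior on $\theta$. A *batch-greedy-style algorithm* with batch size $Y$ divides time into batches of $Y$ consecutive rounds. In each round $t$ it forms an estimate $\theta_t$ of $\theta$ from the pairs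 $(x_s,r_s)$ of the previous batches and an independent random seed, and it chooses an available arm maximizing $\theta_t^\top x_{a,t}$; ties are broken by a strict priority order of the arms that is fixed or depends only on the same data. For a batch $B$ (of $Y$ rounds, within the horizon $T$) let $h_B=((x_t,r_t):t\in B)$ and $Z_B=\sum_{t\in B}x_tx_t^\top$. Put $$\hat R=\rho\sqrt{2\log(2TKd/\delta_R)},\quad \delta_R=T^{-2},\qquad R=1+\hat R\sqrt d .$$ **(1) Data diversity.** Fix $\delta>0$, a batch-greedy-style algorithm and a batch $B$, and assume $$Y\ \ge\ Y_0:=\Big(\frac R\rho\Big)^2\frac{8e^2}{(e-1)^2}\Big(1+\log\frac{2d}\delta\Big)\log T+\frac{4e}{e-1}\log\frac2\delta .$$ Let $\mathcal E_B$ be the event that $\|\varepsilon_{a,t}\|_\infty\le\hat R$ for all arms $a$ and all rounds $t\in B$, and let $h$ be the history before batch $B$. Then, almost surely, $$\Pr\big[\lambda_{\min}(Z_B)\ge R^2\ \big|\ \mathcal E_B,h,\theta\big]\ \ge\ 1-\delta .$$ **(2) Reward simulation.** There are universal constants $C>0$ and $k\in\mathbb N$ such that, for all parameters as above, $1+\rho\sqrt{d\log(TKd)}\le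 R\le 1+C\rho\sqrt{d\log(TKd)}$, and, if $Y\ge C\log^k(dT)/\rho^2$, then for every batch-greedy-style algorithm, with probability at least $1-T^{-2}$, the history of every batch can simulate rewards up to radius $R$. That is: there are measurable functions $g_B(x,h_B)\in\mathbb R$, not depending on $\theta$, such that for every $\theta$, with probability at least $1-T^{-2}$ over the run, the following holds for every batch $B$ and every $x\in\mathbb R^d$ with $\|x\|_2\le R$: conditional on the context vectors $(x_t:t\in B)$, the random variable $g_B(x,h_B)$ has law $\mathcal N(\theta^\top x,1)$. -/

import Mathlib

open MeasureTheory ProbabilityTheory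

namespace LinBandit

/-- The space of context vectors and of latent vectors: `ℝ^d` with the Euclidean norm. -/
abbrev Vec (d : ℕ) : Type := EuclideanSpace ℝ (Fin d)

/-- A tuple with one entry per arm; the entry `Sum.inr ()` means that the arm is unavailable. -/
abbrev ContextTuple (d K : ℕ) : Type := Fin K → Vec d ⊕ Unit

/-- Perturbed context generation with `K` arms in dimension `d`: the perturbation size `ρ` and the
law of the tuple of mean context vectors of a round. -/
structure PerturbedContexts (d K : ℕ) where
  ρ : ℝ
  ρ_pos : 0 < ρ
  ρ_le : ρ ≤ 1 / √(d : ℝ)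
  meanLaw : Measure (ContextTuple d K)
  isProb : IsProbabilityMeasure meanLaw
  norm_mean_le : ∀ᵐ m ∂meanLaw, ∀ a v, m a = Sum.inl v → ‖v‖ ≤ 1
  exists_available : ∀ᵐ m ∂meanLaw, ∃ a v, m a = Sum.inl v

/-- The exogenous randomness of one round: the mean context vectors, the coordinates of the
perturbation of every arm, and the reward noise of every arm. -/
abbrev RoundData (d K : ℕ) : Type :=
  ContextTuple d K × (Fin K → Fin d → ℝ) × (Fin K → ℝ)

/-- The law of a round: the three components are independent, all coordinates of all perturbations
are independent `N(0, ρ²)` and all reward noises are independent `N(0, 1)`. -/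
noncomputable def PerturbedContexts.roundLaw {d K : ℕ} (I : PerturbedContexts d K) :
    Measure (RoundData d K) :=
  I.meanLaw.prod
    ((Measure.pi fun _ : Fin K => Measure.pi fun _ : Fin d =>
        gaussianReal 0 (Real.toNNReal (I.ρ ^ 2))).prod
      (Measure.pi fun _ : Fin K => gaussianReal 0 1))

instance {d K : ℕ} (I : PerturbedContexts d K) : IsProbabilityMeasure I.roundLaw := by
  have := I.isProb
  unfold PerturbedContexts.roundLaw
  infer_instance

/-- The tuple of (perturbed) context vectors that the learner is shown in a round. -/
noncomputable def contexts {d K : ℕ} (z : RoundData d K) : ContextTuple d K :=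
  fun a => Sum.map (fun m : Vec d => m + WithLp.toLp 2 (z.2.1 a)) id (z.1 a)

/-- A batch-greedy-style algorithm with batch size `Y` and a random seed in `S`. Rounds are numbered
`0, 1, 2, …`, so that round `t` lies in batch `t / Y`, and batch `b` consists of the rounds
`b * Y + i` with `i < Y`. In round `t` the algorithm forms an estimate of the latent vector from its
seed and the (context, reward) pairs of the `t / Y * Y` rounds of the previous batches. From the
same data it picks a strict priority order of the arms, which is used only to break ties. -/
structure BatchGreedy (d K Y : ℕ) (S : Type*) [MeasurableSpace S] where
  seedLaw : Measure S
  isProb : IsProbabilityMeasure seedLaw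
  estimate : (t : ℕ) → S → (Fin (t / Y * Y) → Vec d × ℝ) → Vec d
  measurable_estimate : ∀ t,
    Measurable fun p : S × (Fin (t / Y * Y) → Vec d × ℝ) => estimate t p.1 p.2
  rank : (t : ℕ) → S → (Fin (t / Y * Y) → Vec d × ℝ) → Fin K → ℕ
  measurable_rank : ∀ t,
    Measurable fun p : S × (Fin (t / Y * Y) → Vec d × ℝ) => rank t p.1 p.2
  rank_injective : ∀ t s h, Function.Injective (rank t s h)

/-- Arm `p.1` is available with context vector `p.2`, its estimated reward is the largest one among
the available arms, and among the maximizers it has the smallest rank. -/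
def IsGreedyChoice {d K : ℕ} (v : Vec d) (rank : Fin K → ℕ) (c : ContextTuple d K)
    (p : Fin K × Vec d) : Prop :=
  c p.1 = Sum.inl p.2 ∧ ∀ a x, c a = Sum.inl x →
    inner ℝ v x < inner ℝ v p.2 ∨ (inner ℝ v x = inner ℝ v p.2 ∧ rank p.1 ≤ rank a)

open Classical in
/-- The chosen context vector and the realized reward `θᵀ x + η` of a round in which the estimate is
`v` (by convention `(0, 0)` if no arm is available, which has probability zero). -/
noncomputable def outcome {d K : ℕ} (θ v : Vec d) (rank : Fin K → ℕ) (z : RoundData d K) :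
    Vec d × ℝ :=
  if h : ∃ p, IsGreedyChoice v rank (contexts z) p then
    (h.choose.2, inner ℝ θ h.choose.2 + z.2.2 h.choose.1)
  else (0, 0)

section Run

variable {d K Y : ℕ} {S : Type*} [MeasurableSpace S]

/-- The law of the seed and of the exogenous randomness of all rounds: the rounds are i.i.d. and
independent of the seed. It does not depend on the latent vector. -/
noncomputable def runLaw (I : PerturbedContexts d K) (alg : BatchGreedy d K Y S) :
    Measure (S × (ℕ → RoundData d K)) :=
  alg.seedLaw.prod (Measure.infinitePi fun _ : ℕ => I.roundLaw)

instance (I : PerturbedContexts d K) (alg : BatchGreedy d K Y S) :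
    IsProbabilityMeasure (runLaw I alg) := by
  have := alg.isProb
  unfold runLaw
  infer_instance

/-- The history `((x_0, r_0), …, (x_{t-1}, r_{t-1}))` of the first `t` rounds of the run with latent
vector `θ`. -/
noncomputable def history (alg : BatchGreedy d K Y S) (θ : Vec d)
    (ω : S × (ℕ → RoundData d K)) : (t : ℕ) → Fin t → Vec d × ℝ
  | 0 => Fin.elim0
  | t + 1 =>
    let h := history alg θ ω t
    let past : Fin (t / Y * Y) → Vec d × ℝ := fun i => h (Fin.castLE (Nat.div_mul_le_self t Y) i)
    Fin.snoc (α := fun _ => Vec d × ℝ) h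
      (outcome θ (alg.estimate t ω.1 past) (alg.rank t ω.1 past) (ω.2 t))

/-- The batch history `h_B = ((x_t, r_t) : t ∈ B)` of batch number `b`. -/
noncomputable def batchHistory (alg : BatchGreedy d K Y S) (θ : Vec d) (b : ℕ)
    (ω : S × (ℕ → RoundData d K)) : Fin Y → Vec d × ℝ :=
  fun i => history alg θ ω (b * Y + i + 1) (Fin.last _)

/-- The rows `(x_t : t ∈ B)` of the batch context matrix of batch number `b`. -/
noncomputable def batchContexts (alg : BatchGreedy d K Y S) (θ : Vec d) (b : ℕ)
    (ω : S × (ℕ → RoundData d K)) : Fin Y → Vec d :=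
  fun i => (batchHistory alg θ b ω i).1

/-- The batch covariance matrix `∑_{t ∈ B} x_t x_tᵀ` of batch number `b`. -/
noncomputable def batchCovariance (alg : BatchGreedy d K Y S) (θ : Vec d) (b : ℕ)
    (ω : S × (ℕ → RoundData d K)) : Matrix (Fin d) (Fin d) ℝ :=
  ∑ i, Matrix.vecMulVec (batchContexts alg θ b ω i) (batchContexts alg θ b ω i)

/-- The event that all perturbations in batch number `b` are bounded by `r` in the sup norm. -/
def boundedPerturbations (d K Y : ℕ) (S : Type*) (b : ℕ) (r : ℝ) :
    Set (S × (ℕ → RoundData d K)) :=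
  {ω | ∀ i : Fin Y, ∀ a j, |(ω.2 (b * Y + i)).2.1 a j| ≤ r}

/-- Given that the batch contexts of batch number `b` are equal to `X`, the function `g` simulates
rewards up to radius `R` when the latent vector is `θ`: for every context vector `x` with
`‖x‖ ≤ R`, the conditional law of `g x h_B` is `N(θᵀ x, 1)`, the law of the reward of `x`. -/
def SimulatesAt (I : PerturbedContexts d K) (alg : BatchGreedy d K Y S) (b : ℕ) (R : ℝ)
    (g : Vec d → (Fin Y → Vec d × ℝ) → ℝ) (θ : Vec d) (X : Fin Y → Vec d) : Prop :=
  ∀ x : Vec d, ‖x‖ ≤ R →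
    (condDistrib (batchHistory alg θ b) (batchContexts alg θ b) (runLaw I alg) X).map (g x) =
      gaussianReal (inner ℝ θ x) 1

end Run

/-- The smallest eigenvalue of a nonempty real symmetric matrix. -/
noncomputable def lambdaMin {d : ℕ} (A : Matrix (Fin d) (Fin d) ℝ) : ℝ :=
  sInf (spectrum ℝ A)

/-- `R̂ = ρ √(2 log (2 T K d / δ_R))` with `δ_R = T⁻²`. -/
noncomputable def Rhat (d K T : ℕ) (ρ : ℝ) : ℝ :=
  ρ * √(2 * Real.log (2 * T * K * d / ((T : ℝ) ^ 2)⁻¹))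

/-- `R = 1 + R̂ √d`. -/
noncomputable def Rad (d K T : ℕ) (ρ : ℝ) : ℝ :=
  1 + Rhat d K T ρ * √(d : ℝ)

/-- The batch size threshold `Y₀`. -/
noncomputable def Yzero (d K T : ℕ) (ρ δ : ℝ) : ℝ :=
  (Rad d K T ρ / ρ) ^ 2 * (8 * Real.exp 1 ^ 2 / (Real.exp 1 - 1) ^ 2) *
      (1 + Real.log (2 * d / δ)) * Real.log T
    + 4 * Real.exp 1 / (Real.exp 1 - 1) * Real.log (2 / δ)

end LinBandit

/-! During a batch every estimate and every tie-breaking order is a function of the seed and of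
earlier batches. Once the past is fixed, the rounds of the batch are therefore independent, and all
estimates for one batch reduce to a single round with a fixed estimate `v`.

Data diversity of one round. Fix a unit vector `w` with `⟪v, w⟫ ≥ 0` (otherwise use `-w`). Moving
the perturbation of the selected arm by `τ w`, `τ ≥ 0`, keeps that arm selected (`isSelected_shift`)
and moves the projection `y` of the chosen context on `w` to `y + τ`. By the Cameron-Martin formula
this costs a bounded density factor when `τ` is of order `ρ / √(log T)`, because projections of the
perturbations above `ρ √(2 log (2K))` are rare. Since `y` and `y + τ` cannot both be small, the
second moment of `y` is at least `ρ² / (15 log T)`, even after restriction to bounded perturbations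
(`setLIntegral_inner_chosen_sq_ge`).

From one round to a batch. The lower tail of the smallest eigenvalue is controlled without matrix
exponentials. Let `P` be the product of the maps `I - x_i x_iᵀ / (2R²)`. In mean square each factor
shrinks any fixed vector geometrically, so `∑ j, ‖P e_j‖²` is tiny in expectation. A unit vector `u`
with `∑ ⟪u, x_i⟫² < R²` would however force `‖P u‖ ≥ 1/2` (`half_le_norm_contractions`), and
Markov's inequality gives `measure_exists_sum_inner_sq_lt_le`. Integrating over the past yields the
bound on every event of the past, which is equivalent to the conditional statement.

Reward simulation. If the batch covariance is at least `R²` in every direction and `‖x‖ ≤ R`, the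
least squares weights expressing `x` through the `x_i` have sum of squares at most `1`. As `Y > d`,
there is a nonzero linear relation between the `x_i`, orthogonal to these weights; adding a multiple
of it makes the sum of squares exactly `1` (`simWeights_spec`). The batch noises are standard
Gaussian and independent of the batch contexts (`runLaw_map_batchContexts_batchNoise`), so the
weighted sum of the rewards has conditional law `N(⟪θ, x⟫, 1)`. A union bound over rounds and
batches finishes the proof. -/

namespace LinBandit

open scoped Matrix

/-! ### Lower tail of the smallest eigenvalue through products of rank one contractions. -/

section Chernoff

variable {d : ℕ}

/-- The map `y ↦ y - c ⟪x, y⟫ x`. -/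
noncomputable def contraction (c : ℝ) (x : Vec d) : Vec d →ₗ[ℝ] Vec d :=
  LinearMap.id - c • (innerₛₗ ℝ x).smulRight x

lemma contraction_apply (c : ℝ) (x y : Vec d) :
    contraction c x y = y - (c * inner ℝ x y) • x := by
  simp [contraction, smul_smul]

lemma norm_contraction_sq (c : ℝ) (x y : Vec d) :
    ‖contraction c x y‖ ^ 2 = ‖y‖ ^ 2 - (2 * c - c ^ 2 * ‖x‖ ^ 2) * inner ℝ x y ^ 2 := by
  rw [contraction_apply, norm_sub_sq_real, inner_smul_right, norm_smul, mul_pow, Real.norm_eq_abs,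
    sq_abs, real_inner_comm x y]
  ring

/-- For `c = 1 / (2R²)` and `‖x‖ ≤ R` the coefficient `2c - c² ‖x‖²` is at least `1/R² - 1/(4R²)`.
-/
lemma norm_contraction_sq_le {R : ℝ} (hR : 0 < R) {x : Vec d} (hx : ‖x‖ ≤ R) (y : Vec d) :
    ‖contraction (1 / (2 * R ^ 2)) x y‖ ^ 2 ≤ ‖y‖ ^ 2 - 3 / (4 * R ^ 2) * inner ℝ x y ^ 2 := by
  rw [norm_contraction_sq]
  have h3 : 3 / (4 * R ^ 2) ≤ 2 * (1 / (2 * R ^ 2)) - (1 / (2 * R ^ 2)) ^ 2 * ‖x‖ ^ 2 := by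
    have h4 : (1 / (2 * R ^ 2)) ^ 2 * ‖x‖ ^ 2 ≤ (1 / (2 * R ^ 2)) ^ 2 * R ^ 2 := by gcongr
    have h5 : 3 / (4 * R ^ 2) = 2 * (1 / (2 * R ^ 2)) - (1 / (2 * R ^ 2)) ^ 2 * R ^ 2 := by
      field_simp; norm_num
    linarith
  linarith [mul_le_mul_of_nonneg_right h3 (sq_nonneg (inner ℝ x y))]

/-- The composition of the maps `contraction c (X i)`, the one with index `0` being applied
first. -/
noncomputable def contractions (c : ℝ) : (n : ℕ) → (Fin n → Vec d) → Vec d →ₗ[ℝ] Vec d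
  | 0, _ => LinearMap.id
  | n + 1, X => (contractions c n fun i => X i.succ) ∘ₗ contraction c (X 0)

lemma measurable_contractions {α : Type*} [MeasurableSpace α] (c : ℝ) (n : ℕ)
    {X : α → Fin n → Vec d} {y : α → Vec d} (hX : Measurable X) (hy : Measurable y) :
    Measurable fun a => contractions c n (X a) (y a) := by
  induction n generalizing y with
  | zero => simpa [contractions] using hy
  | succ n ih =>
    simp only [contractions, LinearMap.comp_apply]
    refine ih (X := fun a i => X a i.succ) (by fun_prop) ?_
    simp only [contraction_apply]
    fun_prop

/-- Telescoping: `a i` is the inner product of `X i` with the vector to which the `i`-th factor is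
applied. The same coefficients record the total displacement and the total loss of squared norm. -/
lemma exists_coeff_contractions {R : ℝ} (hR : 0 < R) (n : ℕ) (X : Fin n → Vec d)
    (hX : ∀ i, ‖X i‖ ≤ R) (y : Vec d) :
    ∃ a : Fin n → ℝ,
      contractions (1 / (2 * R ^ 2)) n X y = y - (1 / (2 * R ^ 2)) • ∑ i, a i • X i ∧
      ‖contractions (1 / (2 * R ^ 2)) n X y‖ ^ 2 ≤
        ‖y‖ ^ 2 - 3 / (4 * R ^ 2) * ∑ i, a i ^ 2 := by
  induction n generalizing y with
  | zero => exact ⟨0, by simp [contractions]⟩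
  | succ n ih =>
    obtain ⟨a, h1, h2⟩ := ih (fun i => X i.succ) (fun i => hX _)
      (contraction (1 / (2 * R ^ 2)) (X 0) y)
    refine ⟨Fin.cons (inner ℝ (X 0) y) a, ?_, ?_⟩
    · rw [contractions, LinearMap.comp_apply, h1]
      simp only [Fin.sum_univ_succ, Fin.cons_zero, Fin.cons_succ, contraction_apply, smul_add,
        smul_smul]
      abel
    · simp only [contractions, LinearMap.comp_apply, Fin.sum_univ_succ, Fin.cons_zero,
        Fin.cons_succ]
      refine h2.trans ?_
      linarith [norm_contraction_sq_le hR (hX 0) y]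

/-- Let `q` be the norm of the image of `u`. The displacement gives `B ≥ 2R² (1 - q)`, the loss of
norm gives `A ≤ (4R²/3)(1 - q²)`, and Cauchy-Schwarz gives `B² ≤ A R²`. Together `3 (1 - q)² ≤ 1 -
q²`, which fails for `q < 1/2`. -/
lemma half_le_norm_contractions {R : ℝ} (hR : 0 < R) {n : ℕ} (X : Fin n → Vec d)
    (hX : ∀ i, ‖X i‖ ≤ R) {u : Vec d} (hu : ‖u‖ = 1) (hs : ∑ i, inner ℝ u (X i) ^ 2 < R ^ 2) :
    1 / 2 ≤ ‖contractions (1 / (2 * R ^ 2)) n X u‖ := by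
  obtain ⟨a, h1, h2⟩ := exists_coeff_contractions hR n X hX u
  set p := contractions (1 / (2 * R ^ 2)) n X u
  have hq := norm_nonneg p
  have h3 : inner ℝ u p = 1 - (1 / (2 * R ^ 2)) * ∑ i, a i * inner ℝ u (X i) := by
    rw [h1, inner_sub_right, real_inner_self_eq_norm_sq, hu, inner_smul_right, inner_sum]
    simp [inner_smul_right]
  have h4 : inner ℝ u p ≤ ‖p‖ := by simpa [hu] using real_inner_le_norm u p
  have h5 := Finset.sum_mul_sq_le_sq_mul_sq Finset.univ a (fun i => inner ℝ u (X i))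
  set A := ∑ i, a i ^ 2
  set B := ∑ i, a i * inner ℝ u (X i)
  have hA : 0 ≤ A := Finset.sum_nonneg fun i _ => sq_nonneg _
  have hB : B ^ 2 ≤ A * R ^ 2 := h5.trans (by gcongr)
  rw [hu] at h2
  by_contra! hlt
  have hR2 : 0 < R ^ 2 := by positivity
  have h6 : A ≤ 4 * R ^ 2 / 3 * (1 - ‖p‖ ^ 2) := by
    have : 3 / (4 * R ^ 2) * A ≤ 1 - ‖p‖ ^ 2 := by linarith
    have h7 := mul_le_mul_of_nonneg_left this (by positivity : 0 ≤ 4 * R ^ 2 / 3)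
    calc A = 4 * R ^ 2 / 3 * (3 / (4 * R ^ 2) * A) := by field_simp
      _ ≤ _ := h7
  have h8 : 2 * R ^ 2 * (1 - ‖p‖) ≤ B := by
    have : 1 - ‖p‖ ≤ 1 / (2 * R ^ 2) * B := by linarith
    calc 2 * R ^ 2 * (1 - ‖p‖) ≤ 2 * R ^ 2 * (1 / (2 * R ^ 2) * B) := by gcongr
      _ = B := by field_simp
  have h9 : (2 * R ^ 2 * (1 - ‖p‖)) ^ 2 ≤ 4 * R ^ 2 / 3 * (1 - ‖p‖ ^ 2) * R ^ 2 :=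
    (pow_le_pow_left₀ (by have : 0 ≤ 1 - ‖p‖ := by linarith
                          positivity) h8 2).trans (hB.trans (by gcongr))
  have h10 : 3 * (1 - ‖p‖) ^ 2 ≤ (1 - ‖p‖ ^ 2) := by
    have : 0 < 4 * R ^ 2 * R ^ 2 / 3 := by positivity
    refine le_of_mul_le_mul_left ?_ this
    nlinarith [h9]
  nlinarith

variable {Ω : Type*} [MeasurableSpace Ω]

/-- The measure is only finite, because it will be the law of a round restricted to bounded
perturbations. Its mass is kept as a factor so that the powers later combine to the probability of
the batch event. -/
lemma lintegral_norm_contraction_sq_le {R lam : ℝ} (hR : 0 < R) (μ : Measure Ω)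
    [IsFiniteMeasure μ] {x : Ω → Vec d} (hx : Measurable x) (hxR : ∀ᵐ z ∂μ, ‖x z‖ ≤ R)
    (hlam : 0 ≤ lam)
    (hdiv : ∀ w : Vec d, ‖w‖ = 1 →
      ENNReal.ofReal lam * μ Set.univ ≤ ∫⁻ z, ENNReal.ofReal (inner ℝ w (x z) ^ 2) ∂μ)
    (y : Vec d) :
    ∫⁻ z, ENNReal.ofReal (‖contraction (1 / (2 * R ^ 2)) (x z) y‖ ^ 2) ∂μ ≤
      ENNReal.ofReal (1 - 3 / 4 * lam / R ^ 2) * μ Set.univ * ENNReal.ofReal (‖y‖ ^ 2) := by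
  have hR2 : 0 < R ^ 2 := by positivity
  have hdiv' : ENNReal.ofReal (lam * ‖y‖ ^ 2) * μ Set.univ ≤
      ∫⁻ z, ENNReal.ofReal (inner ℝ y (x z) ^ 2) ∂μ := by
    rcases eq_or_ne y 0 with rfl | hy
    · simp
    have h := hdiv (‖y‖⁻¹ • y) (norm_smul_inv_norm hy)
    have h' := mul_le_mul_right h (ENNReal.ofReal (‖y‖ ^ 2))
    rw [← lintegral_const_mul _ (by fun_prop)] at h'
    convert h' using 1
    · rw [ENNReal.ofReal_mul hlam]; ring
    · refine lintegral_congr fun z => ?_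
      rw [← ENNReal.ofReal_mul (by positivity), real_inner_smul_left]
      congr 1
      have : ‖y‖ ≠ 0 := norm_ne_zero_iff.2 hy
      field_simp
  -- The loss is added on the left, since subtraction in `ENNReal` truncates; it is moved across
  -- only once its finiteness is known.
  have hbd : ∀ᵐ z ∂μ, ENNReal.ofReal (‖contraction (1 / (2 * R ^ 2)) (x z) y‖ ^ 2) +
      ENNReal.ofReal (3 / (4 * R ^ 2)) * ENNReal.ofReal (inner ℝ y (x z) ^ 2) ≤
      ENNReal.ofReal (‖y‖ ^ 2) := by
    filter_upwards [hxR] with z hz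
    rw [← ENNReal.ofReal_mul (by positivity), ← ENNReal.ofReal_add (by positivity) (by positivity)]
    refine ENNReal.ofReal_le_ofReal ?_
    rw [real_inner_comm (x z) y]
    linarith [norm_contraction_sq_le hR hz y]
  have hint := lintegral_mono_ae hbd
  have hm : Measurable fun z => ENNReal.ofReal (‖contraction (1 / (2 * R ^ 2)) (x z) y‖ ^ 2) := by
    simp only [contraction_apply]; fun_prop
  rw [lintegral_add_left hm, lintegral_const_mul _ (by fun_prop), lintegral_const] at hint
  set I := ∫⁻ z, ENNReal.ofReal (‖contraction (1 / (2 * R ^ 2)) (x z) y‖ ^ 2) ∂μ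
  have hint2 : I + ENNReal.ofReal (3 / 4 * lam / R ^ 2 * ‖y‖ ^ 2) * μ Set.univ ≤
      ENNReal.ofReal (‖y‖ ^ 2) * μ Set.univ := by
    refine le_trans (add_le_add le_rfl ?_) hint
    refine le_trans (le_of_eq ?_) (mul_le_mul_right hdiv' _)
    rw [← mul_assoc, ← ENNReal.ofReal_mul (by positivity)]
    congr 2
    field_simp
  have hfin : ENNReal.ofReal (3 / 4 * lam / R ^ 2 * ‖y‖ ^ 2) * μ Set.univ ≠ ⊤ :=
    ENNReal.mul_ne_top ENNReal.ofReal_ne_top (measure_ne_top _ _)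
  refine (ENNReal.le_sub_of_add_le_right hfin hint2).trans (le_of_eq ?_)
  rw [← ENNReal.sub_mul (fun _ _ => measure_ne_top _ _), ← ENNReal.ofReal_sub _ (by positivity),
    mul_right_comm, ← ENNReal.ofReal_mul' (by positivity)]
  congr 2
  ring

lemma lintegral_norm_contractions_sq_le {R lam : ℝ} (hR : 0 < R) (μ : Measure Ω)
    [IsFiniteMeasure μ] (hlam : 0 ≤ lam) (n : ℕ) {x : Fin n → Ω → Vec d}
    (hx : ∀ i, Measurable (x i)) (hxR : ∀ i, ∀ᵐ z ∂μ, ‖x i z‖ ≤ R)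
    (hdiv : ∀ i, ∀ w : Vec d, ‖w‖ = 1 →
      ENNReal.ofReal lam * μ Set.univ ≤ ∫⁻ z, ENNReal.ofReal (inner ℝ w (x i z) ^ 2) ∂μ)
    (y : Vec d) :
    ∫⁻ Z, ENNReal.ofReal (‖contractions (1 / (2 * R ^ 2)) n (fun i => x i (Z i)) y‖ ^ 2)
        ∂(Measure.pi fun _ => μ) ≤
      (ENNReal.ofReal (1 - 3 / 4 * lam / R ^ 2) * μ Set.univ) ^ n * ENNReal.ofReal (‖y‖ ^ 2) := by
  induction n generalizing y with
  | zero => simp [contractions]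
  | succ n ih =>
    -- Coordinate `0` belongs to the factor applied first. The induction hypothesis, for a general
    -- starting vector, integrates out the later factors; coordinate `0` is integrated last.
    have hmp := (measurePreserving_piFinSuccAbove (fun _ : Fin (n + 1) => μ) 0).symm
    have hm : Measurable fun Z : Fin (n + 1) → Ω => ENNReal.ofReal
        (‖contractions (1 / (2 * R ^ 2)) (n + 1) (fun i => x i (Z i)) y‖ ^ 2) := by
      have := measurable_contractions (1 / (2 * R ^ 2)) (n + 1)
        (X := fun Z : Fin (n + 1) → Ω => fun i => x i (Z i)) (y := fun _ => y)
        (by fun_prop) measurable_const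
      fun_prop
    have hm' : Measurable fun p : Ω × (Fin n → Ω) => ENNReal.ofReal
        (‖contractions (1 / (2 * R ^ 2)) n (fun i => x i.succ (p.2 i))
          (contraction (1 / (2 * R ^ 2)) (x 0 p.1) y)‖ ^ 2) := by
      have := measurable_contractions (1 / (2 * R ^ 2)) n
        (X := fun p : Ω × (Fin n → Ω) => fun i => x i.succ (p.2 i))
        (y := fun p => contraction (1 / (2 * R ^ 2)) (x 0 p.1) y)
        (by fun_prop) (by simp only [contraction_apply]; fun_prop)
      fun_prop
    rw [← hmp.lintegral_comp hm]
    have h1 : ∀ p : Ω × (Fin n → Ω), ENNReal.ofReal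
        (‖contractions (1 / (2 * R ^ 2)) (n + 1) (fun i => x i
          ((MeasurableEquiv.piFinSuccAbove (fun _ : Fin (n + 1) => Ω) 0).symm p i)) y‖ ^ 2) =
        ENNReal.ofReal
        (‖contractions (1 / (2 * R ^ 2)) n (fun i => x i.succ (p.2 i))
          (contraction (1 / (2 * R ^ 2)) (x 0 p.1) y)‖ ^ 2) := by
      intro p
      simp [contractions, MeasurableEquiv.piFinSuccAbove]
    simp only [h1]
    rw [lintegral_prod _ hm'.aemeasurable]
    calc _ ≤ ∫⁻ z, (ENNReal.ofReal (1 - 3 / 4 * lam / R ^ 2) * μ Set.univ) ^ n *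
          ENNReal.ofReal (‖contraction (1 / (2 * R ^ 2)) (x 0 z) y‖ ^ 2) ∂μ :=
        lintegral_mono fun z => ih (fun i => hx i.succ) (fun i => hxR i.succ)
          (fun i => hdiv i.succ) _
      _ = (ENNReal.ofReal (1 - 3 / 4 * lam / R ^ 2) * μ Set.univ) ^ n *
          ∫⁻ z, ENNReal.ofReal (‖contraction (1 / (2 * R ^ 2)) (x 0 z) y‖ ^ 2) ∂μ := by
        have := hx 0
        exact lintegral_const_mul _ (by simp only [contraction_apply]; fun_prop)
      _ ≤ _ := by
        rw [pow_succ (ENNReal.ofReal _ * _), mul_assoc _ (ENNReal.ofReal _ * _)]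
        exact mul_le_mul_right (lintegral_norm_contraction_sq_le hR μ (hx 0) (hxR 0) hlam
          (hdiv 0) y) _

/-- A lower Chernoff bound for the smallest eigenvalue of a sum of independent rank one
matrices. -/
theorem measure_exists_sum_inner_sq_lt_le {R lam : ℝ} (hR : 0 < R) (μ : Measure Ω)
    [IsFiniteMeasure μ] (hlam : 0 ≤ lam) (n : ℕ) {x : Fin n → Ω → Vec d}
    (hx : ∀ i, Measurable (x i)) (hxR : ∀ i, ∀ᵐ z ∂μ, ‖x i z‖ ≤ R)
    (hdiv : ∀ i, ∀ w : Vec d, ‖w‖ = 1 →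
      ENNReal.ofReal lam * μ Set.univ ≤ ∫⁻ z, ENNReal.ofReal (inner ℝ w (x i z) ^ 2) ∂μ) :
    (Measure.pi fun _ : Fin n => μ)
        {Z | ∃ u : Vec d, ‖u‖ = 1 ∧ ∑ i, inner ℝ u (x i (Z i)) ^ 2 < R ^ 2} ≤
      4 * d * (ENNReal.ofReal (1 - 3 / 4 * lam / R ^ 2) * μ Set.univ) ^ n := by
  set P : (Fin n → Ω) → Vec d →ₗ[ℝ] Vec d :=
    fun Z => contractions (1 / (2 * R ^ 2)) n (fun i => x i (Z i))
  set e : Fin d → Vec d := fun j => EuclideanSpace.basisFun (Fin d) ℝ j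
  have hm : ∀ j, Measurable fun Z => ENNReal.ofReal (‖P Z (e j)‖ ^ 2) := by
    intro j
    have := measurable_contractions (1 / (2 * R ^ 2)) n
        (X := fun Z : Fin n → Ω => fun i => x i (Z i)) (y := fun _ => e j)
        (by fun_prop) measurable_const
    fun_prop
  have hae : ∀ᵐ Z ∂(Measure.pi fun _ : Fin n => μ), ∀ i, ‖x i (Z i)‖ ≤ R :=
    ae_all_iff.2 fun i => (Measure.tendsto_eval_ae_ae (μ := fun _ : Fin n => μ)).eventually (hxR i)
  have hsub : ∀ᵐ Z ∂(Measure.pi fun _ : Fin n => μ),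
      Z ∈ {Z | ∃ u : Vec d, ‖u‖ = 1 ∧ ∑ i, inner ℝ u (x i (Z i)) ^ 2 < R ^ 2} →
      Z ∈ {Z | ENNReal.ofReal (1 / 4) ≤ ∑ j, ENNReal.ofReal (‖P Z (e j)‖ ^ 2)} := by
    filter_upwards [hae] with Z hZ
    rintro ⟨u, hu, hs⟩
    have h1 := half_le_norm_contractions hR (fun i => x i (Z i)) hZ hu hs
    have h2 : P Z u = ∑ j, u j • P Z (e j) := by
      conv_lhs => rw [← (EuclideanSpace.basisFun (Fin d) ℝ).sum_repr u]
      simp [e]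
    have h3 : ‖P Z u‖ ≤ ∑ j, ‖u j‖ * ‖P Z (e j)‖ := by
      rw [h2]
      exact (norm_sum_le _ _).trans (le_of_eq (by simp [norm_smul]))
    -- The Frobenius norm dominates the operator norm, which replaces the unknown direction `u` by
    -- the `d` basis vectors.
    have h4 := Finset.sum_mul_sq_le_sq_mul_sq Finset.univ (fun j => ‖u j‖) (fun j => ‖P Z (e j)‖)
    rw [← EuclideanSpace.norm_sq_eq, hu] at h4
    change ENNReal.ofReal (1 / 4) ≤ _
    rw [← ENNReal.ofReal_sum_of_nonneg (fun _ _ => by positivity)]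
    refine ENNReal.ofReal_le_ofReal ?_
    have h5 : (1 / 2 : ℝ) ^ 2 ≤ (∑ j, ‖u j‖ * ‖P Z (e j)‖) ^ 2 :=
      pow_le_pow_left₀ (by norm_num) (h1.trans h3) 2
    linarith
  refine (measure_mono_ae hsub).trans ?_
  have hmarkov := mul_meas_ge_le_lintegral (μ := Measure.pi fun _ : Fin n => μ)
    (Finset.measurable_fun_sum Finset.univ fun j _ => hm j) (ENNReal.ofReal (1 / 4))
  rw [lintegral_finsetSum _ (fun j _ => hm j)] at hmarkov
  have hsum : ∑ j, ∫⁻ Z, ENNReal.ofReal (‖P Z (e j)‖ ^ 2) ∂(Measure.pi fun _ : Fin n => μ) ≤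
      d * (ENNReal.ofReal (1 - 3 / 4 * lam / R ^ 2) * μ Set.univ) ^ n := by
    refine (Finset.sum_le_sum fun j _ => lintegral_norm_contractions_sq_le hR μ hlam n hx hxR
      hdiv (e j)).trans (le_of_eq ?_)
    simp [e]
  have h4 : (4 : ENNReal) * ENNReal.ofReal (1 / 4) = 1 := by
    rw [show (4 : ENNReal) = ENNReal.ofReal 4 by simp, ← ENNReal.ofReal_mul (by norm_num)]
    norm_num
  have := mul_le_mul_right (hmarkov.trans hsum) 4
  rwa [← mul_assoc, h4, one_mul, ← mul_assoc] at this

end Chernoff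

/-! ### Cameron-Martin shifts and Gaussian tails. -/

section GaussianShift

/-- Both measures agree on boxes: there the integral of a product of functions of separate
coordinates factors, by independence of the coordinates. -/
lemma pi_withDensity {ι : Type*} [Fintype ι] {E : ι → Type*} [∀ i, MeasurableSpace (E i)]
    (μ : ∀ i, Measure (E i)) [∀ i, IsProbabilityMeasure (μ i)] (f : ∀ i, E i → ENNReal)
    (hf : ∀ i, Measurable (f i)) [∀ i, SigmaFinite ((μ i).withDensity (f i))] :
    Measure.pi (fun i => (μ i).withDensity (f i)) =
      (Measure.pi μ).withDensity fun x => ∏ i, f i (x i) := by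
  refine Measure.pi_eq fun s hs => ?_
  have hms : MeasurableSet (Set.univ.pi s) := MeasurableSet.univ_pi hs
  rw [withDensity_apply _ hms, ← lintegral_indicator hms]
  have hm : ∀ i, Measurable ((s i).indicator (f i)) := fun i => (hf i).indicator (hs i)
  have h1 : ∀ x : ∀ i, E i, (Set.univ.pi s).indicator (fun x => ∏ i, f i (x i)) x =
      ∏ i, (s i).indicator (f i) (x i) := by
    intro x
    by_cases hx : x ∈ Set.univ.pi s
    · rw [Set.indicator_of_mem hx]
      exact Finset.prod_congr rfl fun i _ => by rw [Set.indicator_of_mem (hx i (Set.mem_univ i))]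
    · rw [Set.indicator_of_notMem hx]
      simp only [Set.mem_univ_pi, not_forall] at hx
      obtain ⟨i, hi⟩ := hx
      exact (Finset.prod_eq_zero (Finset.mem_univ i) (Set.indicator_of_notMem hi _)).symm
  simp_rw [h1]
  rw [lintegral_prod_eq_prod_lintegral_of_indepFun Finset.univ
    (fun i (x : ∀ i, E i) => (s i).indicator (f i) (x i))
    (iIndepFun_pi fun i => (hm i).aemeasurable) (fun i => (hm i).comp (measurable_pi_apply i))]
  refine Finset.prod_congr rfl fun i _ => ?_
  rw [(measurePreserving_eval μ i).lintegral_comp (hm i), lintegral_indicator (hs i),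
    withDensity_apply _ (hs i)]

lemma gaussianReal_eq_withDensity {v : NNReal} (hv : v ≠ 0) (w : ℝ) :
    gaussianReal w v = (gaussianReal 0 v).withDensity
      fun x => ENNReal.ofReal (Real.exp ((w * x - w ^ 2 / 2) / v)) := by
  rw [gaussianReal_of_var_ne_zero _ hv, gaussianReal_of_var_ne_zero _ hv,
    ← withDensity_mul _ (by fun_prop) (by fun_prop)]
  congr 1
  ext x
  simp only [gaussianPDF, Pi.mul_apply, gaussianPDFReal]
  rw [← ENNReal.ofReal_mul (by positivity), mul_assoc _ (Real.exp _), ← Real.exp_add]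
  congr 3
  have : (v : ℝ) ≠ 0 := by exact_mod_cast hv
  field_simp
  ring

lemma pi_gaussianReal_map_add {ι : Type*} [Fintype ι] {v : NNReal} (hv : v ≠ 0) (w : ι → ℝ) :
    (Measure.pi fun _ : ι => gaussianReal 0 v).map (fun x => x + w) =
      (Measure.pi fun _ : ι => gaussianReal 0 v).withDensity
        fun x => ENNReal.ofReal (Real.exp (∑ i, (w i * x i - w i ^ 2 / 2) / v)) := by
  have h1 : ∀ i, (gaussianReal 0 v).map (fun x => x + w i) = gaussianReal (w i) v := by
    intro i; rw [gaussianReal_map_add_const, zero_add]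
  have h2 : ∀ i, (gaussianReal 0 v).map (fun x => x + w i) = (gaussianReal 0 v).withDensity
      fun x => ENNReal.ofReal (Real.exp ((w i * x - w i ^ 2 / 2) / v)) := by
    intro i; rw [h1, gaussianReal_eq_withDensity hv]
  have : ∀ i, SigmaFinite ((gaussianReal 0 v).withDensity
      fun x => ENNReal.ofReal (Real.exp ((w i * x - w i ^ 2 / 2) / v))) := by
    intro i; rw [← h2, h1]; infer_instance
  have h3 := Measure.pi_map_pi (μ := fun _ : ι => gaussianReal 0 v) (f := fun i x => x + w i)
    (hμ := fun i => by rw [h1]; infer_instance) (fun i => by fun_prop)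
  calc _ = Measure.pi fun i => (gaussianReal 0 v).map (fun x => x + w i) := h3
    _ = _ := by
      simp_rw [h2]
      rw [pi_withDensity _ _ (fun i => by fun_prop)]
      congr 1
      ext x
      rw [Real.exp_sum, ENNReal.ofReal_prod_of_nonneg fun _ _ => (Real.exp_pos _).le]

variable {d K : ℕ}

/-- The law of the perturbations of all arms in one round. -/
noncomputable abbrev perturbationLaw (d K : ℕ) (v : NNReal) : Measure (Fin K → Fin d → ℝ) :=
  Measure.pi fun _ : Fin K => Measure.pi fun _ : Fin d => gaussianReal 0 v

lemma perturbationLaw_map_add {v : NNReal} (hv : v ≠ 0) (W : Fin K → Fin d → ℝ) :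
    (perturbationLaw d K v).map (fun x => x + W) =
      (perturbationLaw d K v).withDensity
        fun x => ENNReal.ofReal (Real.exp (∑ a, ∑ i, (W a i * x a i - W a i ^ 2 / 2) / v)) := by
  have h2 := fun a => pi_gaussianReal_map_add hv (W a)
  have hp : ∀ a, IsProbabilityMeasure ((Measure.pi fun _ : Fin d => gaussianReal 0 v).map
      (fun x => x + W a)) := fun a => Measure.isProbabilityMeasure_map (by fun_prop)
  have : ∀ a, SigmaFinite ((Measure.pi fun _ : Fin d => gaussianReal 0 v).withDensity
      fun x => ENNReal.ofReal (Real.exp (∑ i, (W a i * x i - W a i ^ 2 / 2) / v))) := by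
    intro a
    have := hp a
    rw [← h2]
    infer_instance
  have h3 := Measure.pi_map_pi (μ := fun _ : Fin K => Measure.pi fun _ : Fin d => gaussianReal 0 v)
    (f := fun a x => x + W a) (hμ := fun a => by have := hp a; infer_instance)
    (fun a => by fun_prop)
  calc _ = Measure.pi fun a => (Measure.pi fun _ : Fin d => gaussianReal 0 v).map
        (fun x => x + W a) := h3
    _ = _ := by
      simp_rw [h2]
      rw [pi_withDensity _ _ (fun i => by fun_prop)]
      congr 1
      ext x
      rw [Real.exp_sum, ENNReal.ofReal_prod_of_nonneg fun _ _ => (Real.exp_pos _).le]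

/-- Change of variables with the inverse density as weight: evaluated at `x + W`, it cancels the
density of the shifted law. -/
lemma lintegral_perturbationLaw_add {v : NNReal} (hv : v ≠ 0) (W : Fin K → Fin d → ℝ)
    {F : (Fin K → Fin d → ℝ) → ENNReal} (hF : Measurable F) :
    ∫⁻ x, F (x + W) * ENNReal.ofReal
        (Real.exp (-∑ a, ∑ i, (W a i * x a i + W a i ^ 2 / 2) / v)) ∂(perturbationLaw d K v) =
      ∫⁻ x, F x ∂(perturbationLaw d K v) := by
  have h := lintegral_map (μ := perturbationLaw d K v) (g := fun x => x + W)
    (f := fun x => F x * ENNReal.ofReal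
      (Real.exp (-∑ a, ∑ i, (W a i * x a i - W a i ^ 2 / 2) / v))) (by fun_prop) (by fun_prop)
  rw [perturbationLaw_map_add hv, lintegral_withDensity_eq_lintegral_mul _ (by fun_prop)
    (by fun_prop)] at h
  calc _ = _ := lintegral_congr fun x => by
        congr 4
        refine Finset.sum_congr rfl fun a _ => Finset.sum_congr rfl fun i _ => ?_
        simp only [Pi.add_apply]
        ring
    _ = _ := h.symm
    _ = _ := lintegral_congr fun x => by
        simp only [Pi.mul_apply]
        rw [mul_comm, mul_assoc, ← ENNReal.ofReal_mul (Real.exp_pos _).le, ← Real.exp_add]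
        simp

/-- Shifting the perturbation of arm `a` by `τ` in the direction of the unit vector `w`. -/
lemma lintegral_perturbationLaw_shift {v : NNReal} (hv : v ≠ 0) (a : Fin K) {w : Vec d}
    (hw : ‖w‖ = 1) (τ : ℝ) {F : (Fin K → Fin d → ℝ) → ENNReal} (hF : Measurable F) :
    ∫⁻ x, F (x + Pi.single a (τ • w.ofLp)) * ENNReal.ofReal
        (Real.exp (-(τ * inner ℝ w (WithLp.toLp 2 (x a)) + τ ^ 2 / 2) / v))
        ∂(perturbationLaw d K v) =
      ∫⁻ x, F x ∂(perturbationLaw d K v) := by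
  rw [← lintegral_perturbationLaw_add hv (Pi.single a (τ • w.ofLp)) hF]
  refine lintegral_congr fun x => ?_
  congr 3
  have hw2 : ∑ i, w i ^ 2 = 1 := by
    have := EuclideanSpace.norm_sq_eq w
    rw [hw] at this
    simpa using this.symm
  rw [Finset.sum_eq_single a]
  · simp only [Pi.single_eq_same, Pi.smul_apply, smul_eq_mul, mul_pow, PiLp.inner_apply,
      RCLike.inner_apply, conj_trivial]
    rw [← Finset.sum_div, Finset.sum_add_distrib, ← Finset.sum_div, ← Finset.mul_sum, hw2,
      Finset.mul_sum, neg_div, mul_one]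
    congr 3
    exact Finset.sum_congr rfl fun i _ => by ring
  · intro b _ hb
    simp [Pi.single_eq_of_ne hb]
  · simp

instance (v : NNReal) : IsProbabilityMeasure (perturbationLaw d K v) := by
  unfold perturbationLaw; infer_instance

lemma perturbationLaw_map_neg {v : NNReal} :
    (perturbationLaw d K v).map (fun x => -x) = perturbationLaw d K v := by
  have h1 : (Measure.pi fun _ : Fin d => gaussianReal 0 v).map (fun x => -x) =
      Measure.pi fun _ : Fin d => gaussianReal 0 v := by
    have h := Measure.pi_map_pi (μ := fun _ : Fin d => gaussianReal 0 v) (f := fun _ x => -x)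
      (hμ := fun i => by rw [gaussianReal_map_neg]; infer_instance) (fun i => by fun_prop)
    simp only [gaussianReal_map_neg, neg_zero] at h
    exact h
  have h := Measure.pi_map_pi (μ := fun _ : Fin K => Measure.pi fun _ : Fin d => gaussianReal 0 v)
    (f := fun _ x => -x) (hμ := fun i => by rw [h1]; infer_instance) (fun i => by fun_prop)
  simp only [h1] at h
  exact h

lemma toLp_add_single (x : Fin K → Fin d → ℝ) (a : Fin K) (τ : ℝ) (w : Vec d) :
    WithLp.toLp 2 ((x + Pi.single a (τ • w.ofLp) : Fin K → Fin d → ℝ) a) =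
      WithLp.toLp 2 (x a) + τ • w := by
  rw [Pi.add_apply, Pi.single_eq_same, WithLp.toLp_add, WithLp.toLp_smul, WithLp.toLp_ofLp]

/-- The sharp one-sided Gaussian tail bound. -/
lemma perturbationLaw_lt_inner_le {v : NNReal} (hv : v ≠ 0) (a : Fin K) {w : Vec d}
    (hw : ‖w‖ = 1) {g : ℝ} (hg : 0 ≤ g) :
    perturbationLaw d K v {x | g < inner ℝ w (WithLp.toLp 2 (x a))} ≤
      ENNReal.ofReal (1 / 2 * Real.exp (-g ^ 2 / (2 * v))) := by
  set μ := perturbationLaw d K v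
  have hmeas : ∀ r : ℝ, MeasurableSet {x : Fin K → Fin d → ℝ |
      r < inner ℝ w (WithLp.toLp 2 (x a))} := fun r =>
    measurableSet_lt measurable_const (by fun_prop)
  -- Symmetry of the law supplies the factor `1/2` of the tail bound.
  have hhalf : μ {x | 0 < inner ℝ w (WithLp.toLp 2 (x a))} ≤ ENNReal.ofReal (1 / 2) := by
    have h1 : μ {x | 0 < inner ℝ w (WithLp.toLp 2 (x a))} =
        μ {x | inner ℝ w (WithLp.toLp 2 (x a)) < 0} := by
      have hneg : μ.map (fun x => -x) = μ := perturbationLaw_map_neg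
      conv_lhs => rw [← hneg]
      rw [Measure.map_apply (by fun_prop) (hmeas 0)]
      congr 1
      ext x
      change 0 < inner ℝ w (WithLp.toLp 2 (-(x a))) ↔ inner ℝ w (WithLp.toLp 2 (x a)) < 0
      rw [WithLp.toLp_neg, inner_neg_right, neg_pos]
    have h2 : μ {x | 0 < inner ℝ w (WithLp.toLp 2 (x a))} +
        μ {x | inner ℝ w (WithLp.toLp 2 (x a)) < 0} ≤ 1 := by
      rw [← measure_union _ (measurableSet_lt (by fun_prop) measurable_const)]
      · exact prob_le_one
      · refine Set.disjoint_left.2 fun x hx hx' => lt_asymm (a := (0 : ℝ)) hx hx'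
    rw [← h1, ← two_mul] at h2
    have h3 : ENNReal.ofReal (1 / 2) = 2⁻¹ := by
      rw [one_div, ENNReal.ofReal_inv_of_pos (by norm_num)]; norm_num
    rw [h3, ENNReal.le_inv_iff_mul_le, mul_comm]
    exact h2
  have hind : Measurable (Set.indicator {x : Fin K → Fin d → ℝ |
      g < inner ℝ w (WithLp.toLp 2 (x a))} (1 : (Fin K → Fin d → ℝ) → ENNReal)) :=
    measurable_one.indicator (hmeas g)
  rw [← lintegral_indicator_one (hmeas g), ← lintegral_perturbationLaw_shift hv a hw g hind]
  -- A shift by `g` turns the event of exceeding `g` into that of being positive, and there the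
  -- weight is at most `exp (-g² / (2v))`.
  have hle : ∀ x : Fin K → Fin d → ℝ, Set.indicator {x : Fin K → Fin d → ℝ |
        g < inner ℝ w (WithLp.toLp 2 (x a))} (1 : (Fin K → Fin d → ℝ) → ENNReal)
          (x + Pi.single a (g • w.ofLp)) *
      ENNReal.ofReal (Real.exp (-(g * inner ℝ w (WithLp.toLp 2 (x a)) + g ^ 2 / 2) / v)) ≤
      ENNReal.ofReal (Real.exp (-g ^ 2 / (2 * v))) * Set.indicator {x : Fin K → Fin d → ℝ |
        0 < inner ℝ w (WithLp.toLp 2 (x a))} (1 : (Fin K → Fin d → ℝ) → ENNReal) x := by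
    intro x
    by_cases h0 : 0 < inner ℝ w (WithLp.toLp 2 (x a))
    · rw [Set.indicator_of_mem (show x ∈ {x : Fin K → Fin d → ℝ |
        0 < inner ℝ w (WithLp.toLp 2 (x a))} from h0), mul_comm]
      refine mul_le_mul' (ENNReal.ofReal_le_ofReal (Real.exp_le_exp.2 ?_))
        (Set.indicator_le_self' (fun _ _ => zero_le) _)
      have hv' : (0 : ℝ) < v := by exact_mod_cast pos_iff_ne_zero.2 hv
      rw [show -g ^ 2 / (2 * (v : ℝ)) = -(g ^ 2 / 2) / v by field_simp]
      refine div_le_div_of_nonneg_right ?_ hv'.le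
      nlinarith [mul_nonneg hg h0.le]
    · rw [Set.indicator_of_notMem]
      · simp
      · change ¬ (g < _)
        rw [toLp_add_single, inner_add_right, inner_smul_right, real_inner_self_eq_norm_sq, hw]
        linarith
  refine (lintegral_mono hle).trans ?_
  rw [lintegral_const_mul _ (measurable_one.indicator (hmeas 0)),
    lintegral_indicator_one (hmeas 0), mul_comm, ENNReal.ofReal_mul (by norm_num)]
  gcongr

end GaussianShift

/-! ### The greedy choice: existence, uniqueness and measurability. -/

section Outcome

variable {d K : ℕ}

/-- The context vector of an available arm, and `0` for an unavailable one. -/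
def vecOf (x : Vec d ⊕ Unit) : Vec d := Sum.elim id (fun _ => 0) x

lemma measurable_vecOf : Measurable (vecOf : Vec d ⊕ Unit → Vec d) :=
  measurable_id.sumElim measurable_const

lemma measurableSet_isLeft : MeasurableSet {x : Vec d ⊕ Unit | x.isLeft} := by
  have : {x : Vec d ⊕ Unit | x.isLeft} = Set.range Sum.inl := by
    ext x; cases x <;> simp
  rw [this]
  exact measurableSet_range_inl

lemma eq_inl_iff {x : Vec d ⊕ Unit} {v : Vec d} : x = Sum.inl v ↔ x.isLeft ∧ v = vecOf x := by
  cases x <;> simp [vecOf, eq_comm]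

/-- Arm `a` is the greedy choice for the estimate `v`. -/
def IsSelected (v : Vec d) (rank : Fin K → ℕ) (c : ContextTuple d K) (a : Fin K) : Prop :=
  (c a).isLeft ∧ ∀ a', (c a').isLeft →
    inner ℝ v (vecOf (c a')) < inner ℝ v (vecOf (c a)) ∨
      (inner ℝ v (vecOf (c a')) = inner ℝ v (vecOf (c a)) ∧ rank a ≤ rank a')

lemma isGreedyChoice_iff {v : Vec d} {rank : Fin K → ℕ} {c : ContextTuple d K}
    {p : Fin K × Vec d} :
    IsGreedyChoice v rank c p ↔ IsSelected v rank c p.1 ∧ p.2 = vecOf (c p.1) := by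
  simp only [IsGreedyChoice, IsSelected, eq_inl_iff]
  constructor
  · rintro ⟨⟨h1, h2⟩, h3⟩
    refine ⟨⟨h1, fun a' ha' => ?_⟩, h2⟩
    rw [← h2]
    exact h3 a' _ ⟨ha', rfl⟩
  · rintro ⟨⟨h1, h3⟩, h2⟩
    refine ⟨⟨h1, h2⟩, ?_⟩
    rintro a' x ⟨ha', rfl⟩
    rw [h2]
    exact h3 a' ha'

lemma IsSelected.unique {v : Vec d} {rank : Fin K → ℕ} (hrank : Function.Injective rank)
    {c : ContextTuple d K} {a b : Fin K} (ha : IsSelected v rank c a)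
    (hb : IsSelected v rank c b) : a = b := by
  rcases ha.2 b hb.1 with h1 | ⟨h1, h1'⟩ <;> rcases hb.2 a ha.1 with h2 | ⟨h2, h2'⟩
  · exact absurd h1 (lt_asymm h2)
  · exact absurd h1 (by rw [h2]; exact lt_irrefl _)
  · exact absurd h2 (by rw [h1]; exact lt_irrefl _)
  · exact hrank (le_antisymm h1' h2')

/-- Maximize the estimated reward first, then minimize the rank among the maximizers. -/
lemma exists_isSelected (v : Vec d) (rank : Fin K → ℕ) {c : ContextTuple d K}
    (hc : ∃ a, (c a).isLeft) : ∃ a, IsSelected v rank c a := by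
  classical
  obtain ⟨a₀, ha₀⟩ := hc
  obtain ⟨a₁, ha₁, hmax⟩ := Finset.exists_max_image (Finset.univ.filter fun a => (c a).isLeft)
    (fun a => inner ℝ v (vecOf (c a))) ⟨a₀, by simpa using ha₀⟩
  simp only [Finset.mem_filter, Finset.mem_univ, true_and] at ha₁ hmax
  obtain ⟨a, ha, hmin⟩ := Finset.exists_min_image (Finset.univ.filter fun a => (c a).isLeft ∧
    inner ℝ v (vecOf (c a)) = inner ℝ v (vecOf (c a₁))) rank ⟨a₁, by simpa using ha₁⟩
  simp only [Finset.mem_filter, Finset.mem_univ, true_and, and_imp] at ha hmin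
  refine ⟨a, ha.1, fun a' ha' => ?_⟩
  rcases (hmax a' ha').lt_or_eq with h | h
  · left; rwa [ha.2]
  · right; exact ⟨h.trans ha.2.symm, hmin a' ha' h⟩

lemma outcome_of_isSelected {θ v : Vec d} {rank : Fin K → ℕ} (hrank : Function.Injective rank)
    {z : RoundData d K} {a : Fin K} (h : IsSelected v rank (contexts z) a) :
    outcome θ v rank z = (vecOf (contexts z a), inner ℝ θ (vecOf (contexts z a)) + z.2.2 a) := by
  have hex : ∃ p, IsGreedyChoice v rank (contexts z) p :=
    ⟨(a, vecOf (contexts z a)), isGreedyChoice_iff.2 ⟨h, rfl⟩⟩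
  rw [outcome, dif_pos hex]
  obtain ⟨h1, h2⟩ := isGreedyChoice_iff.1 hex.choose_spec
  rw [h2, h1.unique hrank h]

lemma outcome_of_not_exists {θ v : Vec d} {rank : Fin K → ℕ} {z : RoundData d K}
    (h : ¬ ∃ a, IsSelected v rank (contexts z) a) : outcome θ v rank z = (0, 0) := by
  rw [outcome, dif_neg]
  rintro ⟨p, hp⟩
  exact h ⟨p.1, (isGreedyChoice_iff.1 hp).1⟩

-- By uniqueness at most one summand is nonzero. This form is free of `choose`, so measurability can
-- be read off from it.
open Classical in
lemma outcome_eq_sum {θ v : Vec d} {rank : Fin K → ℕ} (hrank : Function.Injective rank)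
    (z : RoundData d K) :
    outcome θ v rank z = ∑ a, if IsSelected v rank (contexts z) a then
      (vecOf (contexts z a), inner ℝ θ (vecOf (contexts z a)) + z.2.2 a) else 0 := by
  by_cases h : ∃ a, IsSelected v rank (contexts z) a
  · obtain ⟨a, ha⟩ := h
    rw [outcome_of_isSelected hrank ha, Finset.sum_eq_single a, if_pos ha]
    · intro b _ hb
      exact if_neg fun hb' => hb (hb'.unique hrank ha)
    · simp
  · rw [outcome_of_not_exists h]
    push Not at h
    simp [h]

lemma contexts_apply (z : RoundData d K) (a : Fin K) :
    contexts z a = if (z.1 a).isLeft then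
      Sum.inl (vecOf (z.1 a) + WithLp.toLp 2 (z.2.1 a)) else Sum.inr () := by
  rw [contexts]
  cases z.1 a <;> simp [vecOf]

lemma contexts_isLeft (z : RoundData d K) (a : Fin K) :
    (contexts z a).isLeft = (z.1 a).isLeft := by
  rw [contexts]
  cases z.1 a <;> simp

lemma vecOf_contexts (z : RoundData d K) {a : Fin K} (h : (z.1 a).isLeft) :
    vecOf (contexts z a) = vecOf (z.1 a) + WithLp.toLp 2 (z.2.1 a) := by
  rw [contexts_apply, if_pos h]; rfl

lemma measurable_contexts : Measurable (contexts : RoundData d K → ContextTuple d K) := by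
  refine measurable_pi_iff.2 fun a => ?_
  simp only [contexts_apply]
  have hv := measurable_vecOf (d := d)
  refine Measurable.ite ?_ (measurable_inl.comp (by fun_prop)) measurable_const
  exact measurableSet_isLeft.preimage ((measurable_pi_apply a).comp measurable_fst)

variable {α : Type*} [MeasurableSpace α]

lemma measurableSet_isSelected {v : α → Vec d} {rank : α → Fin K → ℕ}
    {c : α → ContextTuple d K} (hv : Measurable v) (hrank : Measurable rank) (hc : Measurable c)
    (a : Fin K) : MeasurableSet {x | IsSelected (v x) (rank x) (c x) a} := by
  have h1 : ∀ a, Measurable fun x => inner ℝ (v x) (vecOf (c x a)) := fun a =>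
    hv.inner (measurable_vecOf.comp ((measurable_pi_apply a).comp hc))
  have h2 : ∀ a, MeasurableSet {x | (c x a).isLeft} := fun a =>
    ((measurable_pi_apply a).comp hc) measurableSet_isLeft
  have h3 : ∀ a, Measurable fun x => rank x a := fun a => (measurable_pi_apply a).comp hrank
  refine (h2 a).inter (MeasurableSet.congr (MeasurableSet.iInter fun a' =>
    (h2 a').compl.union ((measurableSet_lt (h1 a') (h1 a)).union
      ((measurableSet_eq_fun (h1 a') (h1 a)).inter (measurableSet_le (h3 a) (h3 a'))))) ?_)
  ext x
  simp only [Set.mem_iInter, Set.mem_union, Set.mem_compl_iff, imp_iff_not_or]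
  rfl

lemma measurable_outcome (θ : Vec d) {v : α → Vec d} {rank : α → Fin K → ℕ}
    {z : α → RoundData d K} (hv : Measurable v) (hrank : Measurable rank) (hz : Measurable z)
    (hinj : ∀ x, Function.Injective (rank x)) :
    Measurable fun x => outcome θ (v x) (rank x) (z x) := by
  classical
  simp only [outcome_eq_sum (hinj _)]
  have hc := measurable_contexts.comp hz
  refine Finset.measurable_fun_sum _ fun a _ => Measurable.ite
    (measurableSet_isSelected hv hrank hc a) ?_ measurable_const
  have h1 : Measurable fun x => vecOf (contexts (z x) a) :=
    measurable_vecOf.comp ((measurable_pi_apply a).comp hc)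
  fun_prop

end Outcome

/-! ### Separation of a batch from its past. -/

section History

variable {d K Y : ℕ} {S : Type*} [MeasurableSpace S]

/-- Causality: later rounds do not influence the history, so they may be replaced by a default
value. -/
lemma history_congr (alg : BatchGreedy d K Y S) (θ : Vec d) {ω ω' : S × (ℕ → RoundData d K)}
    (h1 : ω.1 = ω'.1) (t : ℕ) (h2 : ∀ k < t, ω.2 k = ω'.2 k) :
    history alg θ ω t = history alg θ ω' t := by
  induction t with
  | zero => rfl
  | succ t ih =>
    simp only [history]
    rw [ih fun k hk => h2 k (hk.trans (Nat.lt_succ_self t)), h1, h2 t (Nat.lt_succ_self t)]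

lemma history_apply (alg : BatchGreedy d K Y S) (θ : Vec d) (ω : S × (ℕ → RoundData d K))
    (t : ℕ) (j : Fin t) :
    history alg θ ω t j = history alg θ ω (j + 1) (Fin.last _) := by
  induction t with
  | zero => exact j.elim0
  | succ t ih =>
    refine Fin.lastCases ?_ (fun j => ?_) j
    · rfl
    · rw [history, Fin.snoc_castSucc, ih]
      rfl

lemma measurable_history (alg : BatchGreedy d K Y S) (θ : Vec d) (t : ℕ) :
    Measurable fun ω : S × (ℕ → RoundData d K) => history alg θ ω t := by
  induction t with
  | zero => exact measurable_const
  | succ t ih =>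
    refine measurable_pi_iff.2 fun j => Fin.lastCases ?_ (fun j => ?_) j
    · simp only [history, Fin.snoc_last]
      have hp : Measurable fun ω : S × (ℕ → RoundData d K) =>
          (ω.1, fun i : Fin (t / Y * Y) =>
            history alg θ ω t (Fin.castLE (Nat.div_mul_le_self t Y) i)) := by
        refine measurable_fst.prodMk (measurable_pi_iff.2 fun i => ?_)
        exact (measurable_pi_apply _).comp ih
      exact measurable_outcome θ ((alg.measurable_estimate t).comp hp)
        ((alg.measurable_rank t).comp hp) (by fun_prop) fun ω => alg.rank_injective t _ _
    · simp only [history, Fin.snoc_castSucc]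
      exact (measurable_pi_apply j).comp ih

lemma measurable_batchHistory (alg : BatchGreedy d K Y S) (θ : Vec d) (b : ℕ) :
    Measurable (batchHistory alg θ b) :=
  measurable_pi_iff.2 fun i =>
    (measurable_pi_apply (Fin.last _)).comp (measurable_history alg θ (b * Y + i + 1))

lemma measurable_batchContexts (alg : BatchGreedy d K Y S) (θ : Vec d) (b : ℕ) :
    Measurable (batchContexts alg θ b) :=
  measurable_pi_iff.2 fun i =>
    measurable_fst.comp ((measurable_pi_apply i).comp (measurable_batchHistory alg θ b))

instance : Inhabited (RoundData d K) := ⟨(fun _ => Sum.inr (), 0, 0)⟩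

/-- The seed and the exogenous randomness of the first `n` rounds, completed by a default value of
the later rounds. -/
def extendPast {n : ℕ} (u : S × (Fin n → RoundData d K)) : S × (ℕ → RoundData d K) :=
  (u.1, fun k => if h : k < n then u.2 ⟨k, h⟩ else default)

lemma measurable_extendPast {n : ℕ} :
    Measurable (extendPast : S × (Fin n → RoundData d K) → S × (ℕ → RoundData d K)) := by
  refine measurable_fst.prodMk (measurable_pi_iff.2 fun k => ?_)
  by_cases h : k < n
  · simp only [h, dite_true]; fun_prop
  · simp only [h, dite_false]; fun_prop

/-- The (context, reward) pairs of the previous batches that are available in round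
`b * Y + i`. -/
noncomputable def pastPairs (alg : BatchGreedy d K Y S) (θ : Vec d) (b : ℕ) (i : Fin Y)
    (u : S × (Fin (b * Y) → RoundData d K)) :
    Fin ((b * Y + i) / Y * Y) → Vec d × ℝ :=
  fun j => history alg θ (extendPast u) (j + 1) (Fin.last _)

lemma measurable_pastPairs (alg : BatchGreedy d K Y S) (θ : Vec d) (b : ℕ) (i : Fin Y) :
    Measurable (pastPairs alg θ b i) :=
  measurable_pi_iff.2 fun j => (measurable_pi_apply (Fin.last _)).comp
    ((measurable_history alg θ (j + 1)).comp measurable_extendPast)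

/-- The outcome of round `b * Y + i` as a function of the past of batch `b` and of the exogenous
randomness of the round. -/
noncomputable def batchOutcome (alg : BatchGreedy d K Y S) (θ : Vec d) (b : ℕ) (i : Fin Y)
    (u : S × (Fin (b * Y) → RoundData d K)) (z : RoundData d K) : Vec d × ℝ :=
  outcome θ (alg.estimate (b * Y + i) u.1 (pastPairs alg θ b i u))
    (alg.rank (b * Y + i) u.1 (pastPairs alg θ b i u)) z

lemma measurable_batchOutcome (alg : BatchGreedy d K Y S) (θ : Vec d) (b : ℕ) (i : Fin Y) :
    Measurable fun p : (S × (Fin (b * Y) → RoundData d K)) × RoundData d K =>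
      batchOutcome alg θ b i p.1 p.2 := by
  have hp : Measurable fun p : (S × (Fin (b * Y) → RoundData d K)) × RoundData d K =>
      (p.1.1, pastPairs alg θ b i p.1) :=
    (by fun_prop : Measurable fun p : (S × (Fin (b * Y) → RoundData d K)) × RoundData d K =>
      p.1.1).prodMk ((measurable_pastPairs alg θ b i).comp measurable_fst)
  exact measurable_outcome θ ((alg.measurable_estimate _).comp hp)
    ((alg.measurable_rank _).comp hp) measurable_snd fun p => alg.rank_injective _ _ _

/-- The past of batch `b` and the exogenous randomness of its rounds. -/
def splitBatch (n Y : ℕ) (ω : S × (ℕ → RoundData d K)) :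
    (S × (Fin n → RoundData d K)) × (Fin Y → RoundData d K) :=
  ((ω.1, fun k => ω.2 k), fun i => ω.2 (n + i))

lemma history_extendPast (alg : BatchGreedy d K Y S) (θ : Vec d) (n : ℕ)
    (ω : S × (ℕ → RoundData d K)) {t : ℕ} (ht : t ≤ n) :
    history alg θ (extendPast (splitBatch n Y ω).1) t = history alg θ ω t := by
  refine history_congr alg θ (by rfl) t fun k hk => ?_
  simp [extendPast, splitBatch, hk.trans_le ht]

lemma batchHistory_eq (alg : BatchGreedy d K Y S) (θ : Vec d) (b : ℕ)
    (ω : S × (ℕ → RoundData d K)) (i : Fin Y) :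
    batchHistory alg θ b ω i =
      batchOutcome alg θ b i (splitBatch (b * Y) Y ω).1 ((splitBatch (b * Y) Y ω).2 i) := by
  -- Every round of the batch sees exactly the pairs before the start of the batch; this is what
  -- freezes the estimates.
  have hdiv : (b * Y + i) / Y * Y = b * Y := by
    rw [mul_comm b, Nat.mul_add_div (i.pos), Nat.div_eq_of_lt i.2, add_zero, mul_comm]
  have hpast : (fun j : Fin ((b * Y + i) / Y * Y) => history alg θ ω (b * Y + i)
      (Fin.castLE (Nat.div_mul_le_self _ Y) j)) =
      pastPairs alg θ b i (splitBatch (b * Y) Y ω).1 := by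
    ext1 j
    rw [history_apply, pastPairs, history_extendPast]
    · rfl
    · have := j.2; omega
  rw [batchHistory, history, Fin.snoc_last, batchOutcome]
  simp only [hpast]
  rfl

/-- The indices `k < n` and `n + i` are distinct, so the corresponding coordinates of the infinite
product are independent; the seed is regrouped with the past. -/
lemma measurePreserving_splitBatch (I : PerturbedContexts d K) (alg : BatchGreedy d K Y S)
    (n Y' : ℕ) :
    MeasurePreserving (splitBatch n Y') (runLaw I alg)
      ((alg.seedLaw.prod (Measure.pi fun _ : Fin n => I.roundLaw)).prod
        (Measure.pi fun _ : Fin Y' => I.roundLaw)) := by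
  have := alg.isProb
  let f : Fin n ⊕ Fin Y' → ℕ := Sum.elim (fun k => (k : ℕ)) (fun i => n + i)
  have hf : Function.Injective f := by
    rintro (k | k) (l | l) h <;> simp only [f, Sum.elim_inl, Sum.elim_inr] at h
    · exact congrArg _ (Fin.ext h)
    · have := k.2; omega
    · have := l.2; omega
    · exact congrArg _ (Fin.ext (by omega))
  have h1 : MeasurePreserving (fun (z : ℕ → RoundData d K) i => z (f i))
      (Measure.infinitePi fun _ : ℕ => I.roundLaw)
      (Measure.pi fun _ : Fin n ⊕ Fin Y' => I.roundLaw) := by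
    refine ⟨by fun_prop, ?_⟩
    rw [Measure.map_infinitePi_infinitePi_of_inj hf, Measure.infinitePi_eq_pi]
  have h2 := measurePreserving_sumPiEquivProdPi (fun _ : Fin n ⊕ Fin Y' => I.roundLaw)
  have h3 := (MeasurePreserving.id alg.seedLaw).prod (h2.comp h1)
  have h4 := (measurePreserving_prodAssoc alg.seedLaw (Measure.pi fun _ : Fin n => I.roundLaw)
    (Measure.pi fun _ : Fin Y' => I.roundLaw)).symm
  exact h4.comp h3

end History

/-! ### Second moment of the chosen context of one round in a fixed direction. -/

section Diversity

variable {d K : ℕ}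

/-- The choice looks only at contexts, so neither the latent vector nor the reward noise affects it.
This justifies the value `0` for both in `chosen`. -/
lemma outcome_fst_eq (θ θ' v : Vec d) {rank : Fin K → ℕ} (hrank : Function.Injective rank)
    (m : ContextTuple d K) (ε : Fin K → Fin d → ℝ) (η η' : Fin K → ℝ) :
    (outcome θ v rank (m, ε, η)).1 = (outcome θ' v rank (m, ε, η')).1 := by
  have hc : contexts ((m, ε, η) : RoundData d K) = contexts ((m, ε, η') : RoundData d K) := rfl
  by_cases h : ∃ a, IsSelected v rank (contexts ((m, ε, η) : RoundData d K)) a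
  · obtain ⟨a, ha⟩ := h
    rw [outcome_of_isSelected hrank ha, outcome_of_isSelected hrank (hc ▸ ha)]
    rfl
  · rw [outcome_of_not_exists h, outcome_of_not_exists (hc ▸ h)]

/-- The shift raises the estimated reward of the selected arm by `τ ⟪v, w⟫ ≥ 0` and leaves all
others unchanged. If the increase is zero, the tie-breaking comparison is unchanged too. -/
lemma isSelected_shift {v w : Vec d} (hvw : 0 ≤ inner ℝ v w) {rank : Fin K → ℕ}
    {m : ContextTuple d K} {ε : Fin K → Fin d → ℝ} {η : Fin K → ℝ} {a : Fin K} {τ : ℝ}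
    (hτ : 0 ≤ τ) (h : IsSelected v rank (contexts ((m, ε, η) : RoundData d K)) a) :
    IsSelected v rank
      (contexts ((m, ε + Pi.single a (τ • w.ofLp), η) : RoundData d K)) a := by
  have h1 : (m a).isLeft := by simpa only [contexts_isLeft] using h.1
  have hpos : 0 ≤ τ * inner ℝ v w := mul_nonneg hτ hvw
  refine ⟨by rw [contexts_isLeft]; exact h1, fun a' ha' => ?_⟩
  rw [contexts_isLeft] at ha'
  have h2 := h.2 a' (by rw [contexts_isLeft]; exact ha')
  have e1 : ∀ ε', vecOf (contexts ((m, ε', η) : RoundData d K) a) =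
      vecOf (m a) + WithLp.toLp 2 (ε' a) := fun ε' => vecOf_contexts _ (a := a) h1
  have e2 : ∀ ε', vecOf (contexts ((m, ε', η) : RoundData d K) a') =
      vecOf (m a') + WithLp.toLp 2 (ε' a') := fun ε' => vecOf_contexts _ (a := a') ha'
  rw [e1, e2] at h2
  rw [e1, e2]
  rw [toLp_add_single, ← add_assoc, inner_add_right v _ (τ • w), inner_smul_right]
  by_cases haa : a' = a
  · subst haa
    right
    refine ⟨?_, le_rfl⟩
    rw [toLp_add_single, ← add_assoc, inner_add_right v _ (τ • w), inner_smul_right]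
  · have h3 : (ε + Pi.single a (τ • w.ofLp) : Fin K → Fin d → ℝ) a' = ε a' := by
      simp [Pi.single_eq_of_ne haa]
    rw [h3]
    rcases h2 with h2 | ⟨h2, h2'⟩
    · left; linarith
    · rcases hpos.lt_or_eq with hp | hp
      · left; linarith
      · right; exact ⟨by linarith, h2'⟩

/-- The context vector chosen in a round with mean context vectors `m` and perturbations `ε`. -/
noncomputable def chosen (v : Vec d) (rank : Fin K → ℕ) (m : ContextTuple d K)
    (ε : Fin K → Fin d → ℝ) : Vec d :=
  (outcome 0 v rank (m, ε, 0)).1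

lemma measurable_chosen (v : Vec d) {rank : Fin K → ℕ} (hrank : Function.Injective rank) :
    Measurable fun p : ContextTuple d K × (Fin K → Fin d → ℝ) => chosen v rank p.1 p.2 :=
  measurable_fst.comp (measurable_outcome 0 (v := fun _ => v) (rank := fun _ => rank)
    (z := fun p : ContextTuple d K × (Fin K → Fin d → ℝ) => (p.1, p.2, 0))
    measurable_const measurable_const (by fun_prop) fun _ => hrank)

lemma chosen_of_isSelected {v : Vec d} {rank : Fin K → ℕ} (hrank : Function.Injective rank)
    {m : ContextTuple d K} {ε : Fin K → Fin d → ℝ} {a : Fin K}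
    (h : IsSelected v rank (contexts ((m, ε, 0) : RoundData d K)) a) :
    chosen v rank m ε = vecOf (m a) + WithLp.toLp 2 (ε a) := by
  rw [chosen, outcome_of_isSelected hrank h,
    vecOf_contexts _ (by simpa only [contexts_isLeft] using h.1)]

/-- The shift is applied to whichever arm is selected, so the space is cut according to the selected
arm, and each piece is mapped into itself. On the event that all projections are at most `g`, the
Cameron-Martin weight is at least the displayed exponential. -/
lemma lintegral_shift_le {v₀ : NNReal} (hv₀ : v₀ ≠ 0) {v w : Vec d} (hw : ‖w‖ = 1)
    (hvw : 0 ≤ inner ℝ v w) {rank : Fin K → ℕ} (hrank : Function.Injective rank)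
    {m : ContextTuple d K} (hm : ∃ a, (m a).isLeft) {τ g : ℝ} (hτ : 0 ≤ τ) {f : ℝ → ENNReal}
    (hf : Measurable f) :
    ENNReal.ofReal (Real.exp (-(τ * g + τ ^ 2 / 2) / v₀)) *
        ∫⁻ ε in {ε | ∀ a, inner ℝ w (WithLp.toLp 2 (ε a)) ≤ g},
          f (inner ℝ w (chosen v rank m ε) + τ) ∂(perturbationLaw d K v₀) ≤
      ∫⁻ ε, f (inner ℝ w (chosen v rank m ε)) ∂(perturbationLaw d K v₀) := by
  classical
  set μ := perturbationLaw d K v₀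
  set C : Fin K → Set (Fin K → Fin d → ℝ) := fun a =>
    {ε | IsSelected v rank (contexts ((m, ε, 0) : RoundData d K)) a}
  set G : Set (Fin K → Fin d → ℝ) := {ε | ∀ a, inner ℝ w (WithLp.toLp 2 (ε a)) ≤ g}
  have hC : ∀ a, MeasurableSet (C a) := fun a =>
    measurableSet_isSelected (v := fun _ => v) (rank := fun _ => rank)
      (c := fun ε => contexts ((m, ε, 0) : RoundData d K)) measurable_const measurable_const
      (measurable_contexts.comp (f := fun ε : Fin K → Fin d → ℝ => (m, ε, (0 : Fin K → ℝ)))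
        (by fun_prop)) a
  have hG : MeasurableSet G := by
    have : G = ⋂ a, {ε | inner ℝ w (WithLp.toLp 2 (ε a)) ≤ g} := by ext; simp [G]
    rw [this]
    exact MeasurableSet.iInter fun a => measurableSet_le (by fun_prop) measurable_const
  have hch : Measurable fun ε => chosen v rank m ε :=
    (measurable_chosen v hrank).comp (measurable_const.prodMk measurable_id)
  have hy : Measurable fun ε => inner ℝ w (chosen v rank m ε) := measurable_const.inner hch
  -- The selection events partition the space for any `m` with an available arm.
  have hsum : ∀ (F : (Fin K → Fin d → ℝ) → ENNReal) ε, F ε = ∑ a, (C a).indicator F ε := by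
    intro F ε
    obtain ⟨a, ha⟩ := exists_isSelected v rank (c := contexts ((m, ε, 0) : RoundData d K))
      (by simpa only [contexts_isLeft] using hm)
    rw [Finset.sum_eq_single a, Set.indicator_of_mem (show ε ∈ C a from ha)]
    · intro b _ hb
      refine Set.indicator_of_notMem ?_ _
      exact fun hb' => hb (IsSelected.unique hrank hb' ha)
    · simp
  have h1 : ∀ a, ENNReal.ofReal (Real.exp (-(τ * g + τ ^ 2 / 2) / v₀)) *
      ∫⁻ ε, (C a).indicator
        (G.indicator fun ε => f (inner ℝ w (chosen v rank m ε) + τ)) ε ∂μ ≤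
      ∫⁻ ε, (C a).indicator (fun ε => f (inner ℝ w (chosen v rank m ε))) ε ∂μ := by
    intro a
    have hFm : Measurable ((C a).indicator fun ε => f (inner ℝ w (chosen v rank m ε))) :=
      (hf.comp hy).indicator (hC a)
    rw [← lintegral_perturbationLaw_shift hv₀ a hw τ hFm, ← lintegral_const_mul]
    · refine lintegral_mono fun ε => ?_
      by_cases hε : ε ∈ C a
      swap
      · simp only [Set.indicator_of_notMem hε, mul_zero]
        exact zero_le
      by_cases hg : ε ∈ G
      swap
      · simp only [Set.indicator_of_mem hε, Set.indicator_of_notMem hg, mul_zero]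
        exact zero_le
      have hε' : ε + Pi.single a (τ • w.ofLp) ∈ C a := isSelected_shift hvw hτ hε
      simp only [Set.indicator_of_mem hε, Set.indicator_of_mem hg, Set.indicator_of_mem hε']
      have hsh : inner ℝ w (chosen v rank m (ε + Pi.single a (τ • w.ofLp))) =
          inner ℝ w (chosen v rank m ε) + τ := by
        rw [chosen_of_isSelected hrank hε', chosen_of_isSelected hrank hε, toLp_add_single,
          ← add_assoc, inner_add_right w _ (τ • w), inner_smul_right,
          real_inner_self_eq_norm_sq, hw]
        ring
      rw [hsh, mul_comm]
      refine mul_le_mul_right (ENNReal.ofReal_le_ofReal (Real.exp_le_exp.2 ?_)) _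
      refine div_le_div_of_nonneg_right ?_ v₀.2
      have := mul_le_mul_of_nonneg_left (hg a) hτ
      linarith
    · exact ((hf.comp (hy.add_const τ)).indicator hG).indicator (hC a)
  have h2 := Finset.sum_le_sum fun a (_ : a ∈ Finset.univ) => h1 a
  rw [← Finset.mul_sum, ← lintegral_finsetSum, ← lintegral_finsetSum] at h2
  · simp only [← hsum] at h2
    rwa [← lintegral_indicator hG]
  · exact fun a _ => (hf.comp hy).indicator (hC a)
  · exact fun a _ => ((hf.comp (hy.add_const τ)).indicator hG).indicator (hC a)

/-- Average the trivial bound for `y` with the shifted bound for `y + τ`: two points at distance `τ`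
cannot both be close to `0`. Truncation at `τ²` makes the later restriction to bounded perturbations
cheap. -/
lemma lintegral_min_sq_ge {v₀ : NNReal} (hv₀ : v₀ ≠ 0) {v w : Vec d} (hw : ‖w‖ = 1)
    (hvw : 0 ≤ inner ℝ v w) {rank : Fin K → ℕ} (hrank : Function.Injective rank)
    {m : ContextTuple d K} (hm : ∃ a, (m a).isLeft) {τ g : ℝ} (hτ : 0 ≤ τ)
    (hκ : 0.165 ≤ Real.exp (-(τ * g + τ ^ 2 / 2) / v₀)) :
    ENNReal.ofReal (0.083 * τ ^ 2) *
        perturbationLaw d K v₀ {ε | ∀ a, inner ℝ w (WithLp.toLp 2 (ε a)) ≤ g} ≤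
      ∫⁻ ε, ENNReal.ofReal (min (inner ℝ w (chosen v rank m ε) ^ 2) (τ ^ 2))
        ∂(perturbationLaw d K v₀) := by
  set μ := perturbationLaw d K v₀
  set G : Set (Fin K → Fin d → ℝ) := {ε | ∀ a, inner ℝ w (WithLp.toLp 2 (ε a)) ≤ g}
  set f : ℝ → ENNReal := fun t => ENNReal.ofReal (min (t ^ 2) (τ ^ 2))
  have hf : Measurable f := by fun_prop
  have hch : Measurable fun ε => chosen v rank m ε :=
    (measurable_chosen v hrank).comp (measurable_const.prodMk measurable_id)
  have hy : Measurable fun ε => inner ℝ w (chosen v rank m ε) := measurable_const.inner hch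
  have h1 := lintegral_shift_le hv₀ hw hvw hrank hm (g := g) hτ hf
  have h2 : ENNReal.ofReal 0.165 * ∫⁻ ε in G, f (inner ℝ w (chosen v rank m ε) + τ) ∂μ ≤
      ∫⁻ ε, f (inner ℝ w (chosen v rank m ε)) ∂μ :=
    (mul_le_mul_left (ENNReal.ofReal_le_ofReal hκ) _).trans h1
  have h3 : ∫⁻ ε in G, f (inner ℝ w (chosen v rank m ε)) ∂μ ≤
      ∫⁻ ε, f (inner ℝ w (chosen v rank m ε)) ∂μ := setLIntegral_le_lintegral _ _
  calc ENNReal.ofReal (0.083 * τ ^ 2) * μ G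
      = ∫⁻ ε in G, ENNReal.ofReal (0.083 * τ ^ 2) ∂μ := by simp
    -- The weights `0.29` and `0.71` are nearly optimal for the factor `0.165`: with `0.71 · 0.165 =
    -- 0.11715`, the minimum of `0.29 y² + 0.11715 (y + τ)²` is about `0.0834 τ²`.
    _ ≤ ∫⁻ ε in G, (ENNReal.ofReal 0.29 * f (inner ℝ w (chosen v rank m ε)) +
          ENNReal.ofReal 0.71 * (ENNReal.ofReal 0.165 *
            f (inner ℝ w (chosen v rank m ε) + τ))) ∂μ := by
        refine lintegral_mono fun ε => ?_
        set y := inner ℝ w (chosen v rank m ε)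
        simp only [f]
        rw [← ENNReal.ofReal_mul (by norm_num), ← ENNReal.ofReal_mul (by norm_num),
          ← ENNReal.ofReal_mul (by norm_num), ← ENNReal.ofReal_add (by positivity)
            (by positivity)]
        refine ENNReal.ofReal_le_ofReal ?_
        have hA : 0 ≤ min (y ^ 2) (τ ^ 2) := by positivity
        have hB : 0 ≤ min ((y + τ) ^ 2) (τ ^ 2) := by positivity
        rcases le_total (y ^ 2) (τ ^ 2) with h | h
        · rcases le_total ((y + τ) ^ 2) (τ ^ 2) with h' | h'
          · rw [min_eq_left h, min_eq_left h']
            nlinarith [sq_nonneg (0.40715 * y + 0.11715 * τ), sq_nonneg τ]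
          · rw [min_eq_right h']
            nlinarith [sq_nonneg τ]
        · rw [min_eq_right h]
          nlinarith [sq_nonneg τ]
    _ = ENNReal.ofReal 0.29 * ∫⁻ ε in G, f (inner ℝ w (chosen v rank m ε)) ∂μ +
          ENNReal.ofReal 0.71 * (ENNReal.ofReal 0.165 *
            ∫⁻ ε in G, f (inner ℝ w (chosen v rank m ε) + τ) ∂μ) := by
        rw [lintegral_add_left (by fun_prop), lintegral_const_mul _ (by fun_prop),
          lintegral_const_mul _ (by fun_prop), lintegral_const_mul _ (by fun_prop)]
    _ ≤ ENNReal.ofReal 0.29 * ∫⁻ ε, f (inner ℝ w (chosen v rank m ε)) ∂μ +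
          ENNReal.ofReal 0.71 * ∫⁻ ε, f (inner ℝ w (chosen v rank m ε)) ∂μ := by gcongr
    _ = ∫⁻ ε, f (inner ℝ w (chosen v rank m ε)) ∂μ := by
        rw [← add_mul, ← ENNReal.ofReal_add (by norm_num) (by norm_num)]
        norm_num

/-- At this threshold the one-sided tail is at most `1/2 · 1/(2K)` per arm; the union bound loses
`1/4`. -/
lemma perturbationLaw_good_ge {ρ : ℝ} (hρ : 0 < ρ) (hK : 1 ≤ K) {w : Vec d} (hw : ‖w‖ = 1) :
    ENNReal.ofReal (3 / 4) ≤ perturbationLaw d K (Real.toNNReal (ρ ^ 2))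
      {ε | ∀ a, inner ℝ w (WithLp.toLp 2 (ε a)) ≤ ρ * √(2 * Real.log (2 * K))} := by
  set v₀ := Real.toNNReal (ρ ^ 2)
  have hv : (v₀ : ℝ) = ρ ^ 2 := Real.coe_toNNReal _ (by positivity)
  have hv₀ : v₀ ≠ 0 := (Real.toNNReal_pos.2 (by positivity)).ne'
  set g := ρ * √(2 * Real.log (2 * K))
  have hK' : (1 : ℝ) ≤ K := by exact_mod_cast hK
  have hlog : 0 ≤ Real.log (2 * K) := Real.log_nonneg (by linarith)
  have hset : {ε : Fin K → Fin d → ℝ | ∀ a, inner ℝ w (WithLp.toLp 2 (ε a)) ≤ g} =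
      (⋃ a, {ε | g < inner ℝ w (WithLp.toLp 2 (ε a))})ᶜ := by
    ext; simp
  have hm : MeasurableSet (⋃ a, {ε : Fin K → Fin d → ℝ | g < inner ℝ w (WithLp.toLp 2 (ε a))}) :=
    MeasurableSet.iUnion fun a => measurableSet_lt measurable_const (by fun_prop)
  have hexp : Real.exp (-g ^ 2 / (2 * v₀)) = (2 * K : ℝ)⁻¹ := by
    rw [hv, show -g ^ 2 / (2 * ρ ^ 2) = -Real.log (2 * K) by
      simp only [g]
      rw [mul_pow, Real.sq_sqrt (by positivity)]
      field_simp, Real.exp_neg, Real.exp_log (by positivity)]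
  have hb : perturbationLaw d K v₀ (⋃ a, {ε | g < inner ℝ w (WithLp.toLp 2 (ε a))}) ≤
      ENNReal.ofReal (1 / 4) := by
    refine (measure_iUnion_fintype_le _ _).trans ((Finset.sum_le_sum fun a _ =>
      perturbationLaw_lt_inner_le hv₀ a hw (by positivity)).trans ?_)
    rw [hexp, Finset.sum_const, Finset.card_univ, Fintype.card_fin, nsmul_eq_mul,
      ← ENNReal.ofReal_natCast, ← ENNReal.ofReal_mul (by positivity)]
    refine ENNReal.ofReal_le_ofReal (le_of_eq ?_)
    field_simp
    norm_num
  rw [hset, prob_compl_eq_one_sub hm]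
  refine le_trans ?_ (tsub_le_tsub_left hb 1)
  rw [← ENNReal.ofReal_one, ← ENNReal.ofReal_sub _ (by norm_num)]
  norm_num

/-- All perturbations of one round are bounded by `r`. -/
def boundedRound (d K : ℕ) (r : ℝ) : Set (Fin K → Fin d → ℝ) := {ε | ∀ a j, |ε a j| ≤ r}

lemma measurableSet_boundedRound (r : ℝ) : MeasurableSet (boundedRound d K r) := by
  have : boundedRound d K r = ⋂ a, ⋂ j, {ε | |ε a j| ≤ r} := by ext; simp [boundedRound]
  rw [this]
  refine MeasurableSet.iInter fun a => MeasurableSet.iInter fun j => ?_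
  have : Measurable fun ε : Fin K → Fin d → ℝ => ε a j := by fun_prop
  exact measurableSet_le (continuous_abs.measurable.comp this) measurable_const

lemma exp_Rhat {T : ℕ} (hd : 1 ≤ d) (hK : 1 ≤ K) (hT : 1 ≤ T) {ρ : ℝ} (hρ : 0 < ρ) :
    Real.exp (-Rhat d K T ρ ^ 2 / (2 * ρ ^ 2)) = (2 * (T : ℝ) ^ 3 * K * d)⁻¹ := by
  have hd' : (1 : ℝ) ≤ d := by exact_mod_cast hd
  have hK' : (1 : ℝ) ≤ K := by exact_mod_cast hK
  have hT' : (1 : ℝ) ≤ T := by exact_mod_cast hT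
  have h1 : 2 * (T : ℝ) * K * d / ((T : ℝ) ^ 2)⁻¹ = 2 * (T : ℝ) ^ 3 * K * d := by
    field_simp
  have h2 : 1 ≤ 2 * (T : ℝ) ^ 3 * K * d := by
    have : 1 ≤ (T : ℝ) ^ 3 := one_le_pow₀ hT'
    have h3 : 1 ≤ 2 * (T : ℝ) ^ 3 := by linarith
    exact one_le_mul_of_one_le_of_one_le (one_le_mul_of_one_le_of_one_le h3 hK') hd'
  have h3 := Real.log_nonneg h2
  rw [Rhat, h1, mul_pow, Real.sq_sqrt (by positivity),
    show -(ρ ^ 2 * (2 * Real.log (2 * (T : ℝ) ^ 3 * K * d))) / (2 * ρ ^ 2) =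
      -Real.log (2 * (T : ℝ) ^ 3 * K * d) by field_simp, Real.exp_neg,
    Real.exp_log (by positivity)]

/-- A union bound over `K d` coordinates and two signs, each with tail at most `1/2 · 1/(2 T³ K d)`.
-/
lemma perturbationLaw_boundedRound_compl_le {T : ℕ} (hd : 1 ≤ d) (hK : 1 ≤ K) (hT : 1 ≤ T)
    {ρ : ℝ} (hρ : 0 < ρ) :
    perturbationLaw d K (Real.toNNReal (ρ ^ 2)) (boundedRound d K (Rhat d K T ρ))ᶜ ≤
      ENNReal.ofReal (1 / (2 * (T : ℝ) ^ 3)) := by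
  set v₀ := Real.toNNReal (ρ ^ 2)
  have hv : (v₀ : ℝ) = ρ ^ 2 := Real.coe_toNNReal _ (by positivity)
  have hv₀ : v₀ ≠ 0 := (Real.toNNReal_pos.2 (by positivity)).ne'
  have hd' : (1 : ℝ) ≤ d := by exact_mod_cast hd
  have hK' : (1 : ℝ) ≤ K := by exact_mod_cast hK
  have hT' : (1 : ℝ) ≤ T := by exact_mod_cast hT
  set r := Rhat d K T ρ
  have hr : 0 ≤ r := by simp only [r, Rhat]; positivity
  have hsub : (boundedRound d K r)ᶜ ⊆ ⋃ a, ⋃ j,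
      ({ε | r < inner ℝ (EuclideanSpace.single j (1 : ℝ)) (WithLp.toLp 2 (ε a))} ∪
        {ε | r < inner ℝ (-EuclideanSpace.single j (1 : ℝ)) (WithLp.toLp 2 (ε a))}) := by
    intro ε hε
    simp only [boundedRound, Set.mem_compl_iff] at hε
    change ¬ (∀ a j, |ε a j| ≤ r) at hε
    push Not at hε
    obtain ⟨a, j, h⟩ := hε
    refine Set.mem_iUnion.2 ⟨a, Set.mem_iUnion.2 ⟨j, ?_⟩⟩
    rcases lt_abs.1 h with h | h
    · left
      change r < inner ℝ _ _
      simpa [EuclideanSpace.inner_single_left] using h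
    · right
      change r < inner ℝ _ _
      simpa [EuclideanSpace.inner_single_left] using h
  have hn : ∀ j : Fin d, ‖(EuclideanSpace.single j (1 : ℝ) : Vec d)‖ = 1 := by simp
  calc _ ≤ ∑ _a : Fin K, ∑ _j : Fin d,
        (ENNReal.ofReal (1 / 2 * Real.exp (-r ^ 2 / (2 * v₀))) +
          ENNReal.ofReal (1 / 2 * Real.exp (-r ^ 2 / (2 * v₀)))) := by
        refine (measure_mono hsub).trans ((measure_iUnion_fintype_le _ _).trans
          (Finset.sum_le_sum fun a _ => (measure_iUnion_fintype_le _ _).trans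
          (Finset.sum_le_sum fun j _ => (measure_union_le _ _).trans (add_le_add ?_ ?_))))
        · exact perturbationLaw_lt_inner_le hv₀ a (hn j) hr
        · exact perturbationLaw_lt_inner_le hv₀ a (by rw [norm_neg, hn j]) hr
    _ = _ := by
        rw [hv, exp_Rhat hd hK hT hρ, ← ENNReal.ofReal_add (by positivity) (by positivity)]
        simp only [Finset.sum_const, Finset.card_univ, Fintype.card_fin, nsmul_eq_mul]
        rw [← ENNReal.ofReal_natCast, ← ENNReal.ofReal_natCast,
          ← ENNReal.ofReal_mul (by positivity), ← ENNReal.ofReal_mul (by positivity)]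
        congr 1
        field_simp
        norm_num

/-- The exponent is at least `-9/5`, and `exp (-9/5) > 0.165`. Here `T ≥ 4K` enters: it gives `log
(2K) ≤ log T - log 2` and `log T ≥ 2 log 2`, so that the slack `x = log 2 / log T` pays for the
quadratic term of the shift. -/
lemma exp_shift_ge {T : ℕ} (hK : 1 ≤ K) (hKT : 4 * K ≤ T) {ρ : ℝ} (hρ : 0 < ρ) :
    0.165 ≤ Real.exp (-(6 / 5 * ρ / √(Real.log T) * (ρ * √(2 * Real.log (2 * K))) +
      (6 / 5 * ρ / √(Real.log T)) ^ 2 / 2) / ρ ^ 2) := by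
  have hK' : (1 : ℝ) ≤ K := by exact_mod_cast hK
  have hKT' : 4 * (K : ℝ) ≤ T := by exact_mod_cast hKT
  set L := Real.log T
  have hl2 := Real.log_two_gt_d9
  have hL : 2 * Real.log 2 ≤ L := by
    have h4 : Real.log 4 = 2 * Real.log 2 := by
      rw [show (4 : ℝ) = 2 ^ 2 by norm_num, Real.log_pow]; norm_num
    rw [← h4]
    exact Real.log_le_log (by norm_num) (by linarith)
  have hg : Real.log (2 * K) ≤ L - Real.log 2 := by
    rw [← Real.log_div (by linarith) (by norm_num)]
    exact Real.log_le_log (by linarith) (by linarith)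
  have hg0 : 0 ≤ Real.log (2 * K) := Real.log_nonneg (by linarith)
  have hLpos : 0 < L := by linarith
  set x := Real.log 2 / L
  have hx : 0 < x := by positivity
  have hx1 : x ≤ 1 / 2 := by
    simp only [x]; rw [div_le_div_iff₀ hLpos (by norm_num)]; linarith
  have e1 : -(6 / 5 * ρ / √L * (ρ * √(2 * Real.log (2 * K))) +
      (6 / 5 * ρ / √L) ^ 2 / 2) / ρ ^ 2 =
      -(6 / 5 * √(2 * Real.log (2 * K) / L) + 18 / 25 / L) := by
    rw [Real.sqrt_div' _ hLpos.le, div_pow, Real.sq_sqrt hLpos.le]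
    field_simp
    ring
  have h2 : √(2 * Real.log (2 * K) / L) ≤ (9 / 5 - 26 / 25 * x) / (6 / 5) := by
    rw [Real.sqrt_le_left (by linarith)]
    have : 2 * Real.log (2 * K) / L ≤ 2 * (1 - x) := by
      rw [div_le_iff₀ hLpos]
      have : 2 * (1 - x) * L = 2 * (L - Real.log 2) := by simp only [x]; field_simp
      rw [this]; linarith
    nlinarith [sq_nonneg (x - 2 / 5)]
  -- This is `18/25 ≤ (26/25) log 2`, which holds narrowly and explains the coefficient `26/25`.
  have h3 : 18 / 25 / L ≤ 26 / 25 * x := by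
    simp only [x]
    rw [← mul_div_assoc]
    exact div_le_div_of_nonneg_right (by linarith) hLpos.le
  have h4 : (0.165 : ℝ) ≤ Real.exp (-(9 / 5)) := by
    rw [Real.exp_neg, ← one_div, le_div_iff₀ (Real.exp_pos _)]
    -- The fifth power is `(exp 1)⁹`, for which decimal bounds are known.
    have h5 : Real.exp (9 / 5) ^ 5 ≤ 6.06 ^ 5 := by
      rw [← Real.exp_nat_mul]
      have : Real.exp (((5 : ℕ) : ℝ) * (9 / 5)) = Real.exp 1 ^ 9 := by
        rw [← Real.exp_nat_mul]; norm_num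
      rw [this]
      calc Real.exp 1 ^ 9 ≤ 2.7183 ^ 9 := by
            have := Real.exp_one_lt_d9
            gcongr
            linarith
        _ ≤ _ := by norm_num
    have h6 : Real.exp (9 / 5) ≤ 6.06 := le_of_pow_le_pow_left₀ (by norm_num) (by norm_num) h5
    linarith
  rw [e1]
  refine h4.trans (Real.exp_le_exp.2 ?_)
  linarith

/-- Outside the bounded event the truncated square contributes at most `τ² / 128`, since `2T³ ≥
128`. What remains is `(0.083 · 3/4 - 1/128) τ²` with `τ² = 1.44 ρ² / log T`, which exceeds `ρ² /
(15 log T)`. -/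
lemma setLIntegral_inner_chosen_sq_ge_aux {T : ℕ} (hd : 1 ≤ d) (hK : 1 ≤ K) (hKT : 4 * K ≤ T)
    {ρ : ℝ} (hρ : 0 < ρ) {v w : Vec d} (hw : ‖w‖ = 1) (hvw : 0 ≤ inner ℝ v w)
    {rank : Fin K → ℕ} (hrank : Function.Injective rank) {m : ContextTuple d K}
    (hm : ∃ a, (m a).isLeft) :
    ENNReal.ofReal (ρ ^ 2 / (15 * Real.log T)) ≤
      ∫⁻ ε in boundedRound d K (Rhat d K T ρ), ENNReal.ofReal (inner ℝ w (chosen v rank m ε) ^ 2)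
        ∂(perturbationLaw d K (Real.toNNReal (ρ ^ 2))) := by
  set v₀ := Real.toNNReal (ρ ^ 2)
  have hv : (v₀ : ℝ) = ρ ^ 2 := Real.coe_toNNReal _ (by positivity)
  have hv₀ : v₀ ≠ 0 := (Real.toNNReal_pos.2 (by positivity)).ne'
  have hT4 : (4 : ℝ) ≤ T := by exact_mod_cast (by omega : 4 ≤ T)
  have hL : 0 < Real.log T := Real.log_pos (by linarith)
  set τ := 6 / 5 * ρ / √(Real.log T)
  have hτ : 0 ≤ τ := by positivity
  have hτ2 : τ ^ 2 = 36 / 25 * (ρ ^ 2 / Real.log T) := by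
    simp only [τ]; rw [div_pow, Real.sq_sqrt hL.le]; ring
  set μ := perturbationLaw d K v₀
  set E := boundedRound d K (Rhat d K T ρ)
  have hE : MeasurableSet E := measurableSet_boundedRound _
  have h1 := lintegral_min_sq_ge (d := d) hv₀ hw hvw hrank hm hτ
    (g := ρ * √(2 * Real.log (2 * K))) (by rw [hv]; exact exp_shift_ge hK hKT hρ)
  have h2 : ENNReal.ofReal (0.083 * τ ^ 2 * (3 / 4)) ≤
      ∫⁻ ε, ENNReal.ofReal (min (inner ℝ w (chosen v rank m ε) ^ 2) (τ ^ 2)) ∂μ := by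
    rw [ENNReal.ofReal_mul (by positivity)]
    exact (mul_le_mul_right (perturbationLaw_good_ge hρ hK hw) _).trans h1
  have h3 : ∫⁻ ε, ENNReal.ofReal (min (inner ℝ w (chosen v rank m ε) ^ 2) (τ ^ 2)) ∂μ ≤
      ∫⁻ ε in E, ENNReal.ofReal (inner ℝ w (chosen v rank m ε) ^ 2) ∂μ +
        ENNReal.ofReal (τ ^ 2 * (1 / 128)) := by
    rw [← lintegral_add_compl _ hE]
    refine add_le_add (lintegral_mono fun ε => ENNReal.ofReal_le_ofReal (min_le_left _ _)) ?_
    calc _ ≤ ∫⁻ _ in Eᶜ, ENNReal.ofReal (τ ^ 2) ∂μ :=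
          lintegral_mono fun ε => ENNReal.ofReal_le_ofReal (min_le_right _ _)
      _ = ENNReal.ofReal (τ ^ 2) * μ Eᶜ := by simp
      _ ≤ ENNReal.ofReal (τ ^ 2) * ENNReal.ofReal (1 / 128) := by
          refine mul_le_mul_right ((perturbationLaw_boundedRound_compl_le hd hK
            (by omega) hρ).trans (ENNReal.ofReal_le_ofReal ?_)) _
          refine one_div_le_one_div_of_le (by norm_num) ?_
          have : (4 : ℝ) ^ 3 ≤ (T : ℝ) ^ 3 := pow_le_pow_left₀ (by norm_num) hT4 3
          linarith
      _ = _ := by rw [← ENNReal.ofReal_mul (by positivity)]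
  have h4 := tsub_le_iff_right.2 (h2.trans h3)
  rw [← ENNReal.ofReal_sub _ (by positivity)] at h4
  refine le_trans (ENNReal.ofReal_le_ofReal ?_) h4
  rw [hτ2, show ρ ^ 2 / (15 * Real.log T) = 1 / 15 * (ρ ^ 2 / Real.log T) by field_simp]
  have : 0 ≤ ρ ^ 2 / Real.log T := by positivity
  linarith

lemma setLIntegral_inner_chosen_sq_ge {T : ℕ} (hd : 1 ≤ d) (hK : 1 ≤ K) (hKT : 4 * K ≤ T)
    {ρ : ℝ} (hρ : 0 < ρ) (v : Vec d) {w : Vec d} (hw : ‖w‖ = 1)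
    {rank : Fin K → ℕ} (hrank : Function.Injective rank) {m : ContextTuple d K}
    (hm : ∃ a, (m a).isLeft) :
    ENNReal.ofReal (ρ ^ 2 / (15 * Real.log T)) ≤
      ∫⁻ ε in boundedRound d K (Rhat d K T ρ), ENNReal.ofReal (inner ℝ w (chosen v rank m ε) ^ 2)
        ∂(perturbationLaw d K (Real.toNNReal (ρ ^ 2))) := by
  rcases le_total 0 (inner ℝ v w) with h | h
  · exact setLIntegral_inner_chosen_sq_ge_aux hd hK hKT hρ hw h hrank hm
  · have := setLIntegral_inner_chosen_sq_ge_aux hd hK hKT hρ (v := v) (w := -w)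
      (by rwa [norm_neg]) (by rw [inner_neg_right]; linarith) hrank hm
    simpa only [inner_neg_left, neg_sq] using this

end Diversity

/-! ### The moment and norm bounds under the full law of a round. -/

section RoundLaw

variable {d K : ℕ}

/-- The event that all perturbations of one round are bounded by `r`. -/
def roundEvent (d K : ℕ) (r : ℝ) : Set (RoundData d K) := {z | z.2.1 ∈ boundedRound d K r}

lemma measurableSet_roundEvent (r : ℝ) : MeasurableSet (roundEvent d K r) :=
  (measurable_fst.comp measurable_snd) (measurableSet_boundedRound r)

lemma ae_roundLaw_of_meanLaw (I : PerturbedContexts d K) {p : ContextTuple d K → Prop}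
    (h : ∀ᵐ m ∂I.meanLaw, p m) : ∀ᵐ z ∂I.roundLaw, p z.1 := by
  have := I.isProb
  exact Measure.quasiMeasurePreserving_fst.ae h

lemma ae_exists_isLeft (I : PerturbedContexts d K) :
    ∀ᵐ m ∂I.meanLaw, ∃ a, (m a).isLeft := by
  filter_upwards [I.exists_available] with m hm
  obtain ⟨a, v, h⟩ := hm
  exact ⟨a, by rw [h]; rfl⟩

lemma lintegral_roundLaw (I : PerturbedContexts d K) {F : RoundData d K → ENNReal}
    (hF : Measurable F) :
    ∫⁻ z, F z ∂I.roundLaw = ∫⁻ m, ∫⁻ ε, ∫⁻ η, F (m, ε, η)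
      ∂(Measure.pi fun _ : Fin K => gaussianReal 0 1)
      ∂(perturbationLaw d K (Real.toNNReal (I.ρ ^ 2))) ∂I.meanLaw := by
  have := I.isProb
  rw [PerturbedContexts.roundLaw, lintegral_prod _ hF.aemeasurable]
  refine lintegral_congr fun m => ?_
  rw [lintegral_prod]
  exact (hF.comp (by fun_prop)).aemeasurable

lemma roundLaw_roundEvent_compl_le (I : PerturbedContexts d K) {T : ℕ} (hd : 1 ≤ d) (hK : 1 ≤ K)
    (hT : 1 ≤ T) :
    I.roundLaw (roundEvent d K (Rhat d K T I.ρ))ᶜ ≤ ENNReal.ofReal (1 / (2 * (T : ℝ) ^ 3)) := by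
  have := I.isProb
  refine le_trans (le_of_eq ?_) (perturbationLaw_boundedRound_compl_le hd hK hT I.ρ_pos)
  have h1 : (roundEvent d K (Rhat d K T I.ρ))ᶜ =
      Set.univ ×ˢ ((boundedRound d K (Rhat d K T I.ρ))ᶜ ×ˢ Set.univ) := by
    ext z; simp [roundEvent]
  rw [h1, PerturbedContexts.roundLaw, Measure.prod_prod, Measure.prod_prod]
  simp

lemma measurable_outcome_round (θ v : Vec d) {rank : Fin K → ℕ}
    (hrank : Function.Injective rank) : Measurable fun z => outcome θ v rank z :=
  measurable_outcome θ (v := fun _ => v) (rank := fun _ => rank) measurable_const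
    measurable_const measurable_id fun _ => hrank

/-- The bound for fixed means holds for almost every `m`, namely whenever some arm is available, and
is uniform in `m`. -/
lemma setLIntegral_inner_outcome_sq_ge (I : PerturbedContexts d K) {T : ℕ} (hd : 1 ≤ d)
    (hK : 1 ≤ K) (hKT : 4 * K ≤ T) (θ v : Vec d) {w : Vec d} (hw : ‖w‖ = 1)
    {rank : Fin K → ℕ} (hrank : Function.Injective rank) :
    ENNReal.ofReal (I.ρ ^ 2 / (15 * Real.log T)) ≤
      ∫⁻ z in roundEvent d K (Rhat d K T I.ρ),
        ENNReal.ofReal (inner ℝ w (outcome θ v rank z).1 ^ 2) ∂I.roundLaw := by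
  have := I.isProb
  have hE := measurableSet_roundEvent (d := d) (K := K) (Rhat d K T I.ρ)
  have ho := measurable_outcome_round θ v hrank
  rw [← lintegral_indicator hE, lintegral_roundLaw I
    ((by fun_prop : Measurable _).indicator hE)]
  calc _ = ∫⁻ _, ENNReal.ofReal (I.ρ ^ 2 / (15 * Real.log T)) ∂I.meanLaw := by simp
    _ ≤ _ := by
      refine lintegral_mono_ae ?_
      filter_upwards [ae_exists_isLeft I] with m hm
      refine (setLIntegral_inner_chosen_sq_ge hd hK hKT I.ρ_pos v hw hrank hm).trans ?_
      rw [← lintegral_indicator (measurableSet_boundedRound _)]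
      refine lintegral_mono fun ε => ?_
      have h1 : ∀ η : Fin K → ℝ, (roundEvent d K (Rhat d K T I.ρ)).indicator (fun z =>
          ENNReal.ofReal (inner ℝ w (outcome θ v rank z).1 ^ 2)) (m, ε, η) =
          (boundedRound d K (Rhat d K T I.ρ)).indicator (fun ε =>
            ENNReal.ofReal (inner ℝ w (chosen v rank m ε) ^ 2)) ε := by
        intro η
        by_cases h : ε ∈ boundedRound d K (Rhat d K T I.ρ)
        · rw [Set.indicator_of_mem h, Set.indicator_of_mem (by exact h), chosen,
            outcome_fst_eq θ 0 v hrank m ε η 0]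
        · rw [Set.indicator_of_notMem h, Set.indicator_of_notMem (by exact h)]
      simp only [h1, lintegral_const, measure_univ, mul_one]
      exact le_rfl

lemma Rhat_nonneg (T : ℕ) {ρ : ℝ} (hρ : 0 < ρ) : 0 ≤ Rhat d K T ρ :=
  mul_nonneg hρ.le (Real.sqrt_nonneg _)

lemma one_le_Rad (T : ℕ) {ρ : ℝ} (hρ : 0 < ρ) : 1 ≤ Rad d K T ρ := by
  have := Rhat_nonneg (d := d) (K := K) T hρ
  rw [Rad]
  have : 0 ≤ Rhat d K T ρ * √(d : ℝ) := by positivity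
  linarith

lemma norm_toLp_le {r : ℝ} (hr : 0 ≤ r) {e : Fin d → ℝ} (he : ∀ j, |e j| ≤ r) :
    ‖(WithLp.toLp 2 e : Vec d)‖ ≤ r * √(d : ℝ) := by
  rw [EuclideanSpace.norm_eq]
  refine Real.sqrt_le_iff.2 ⟨by positivity, ?_⟩
  rw [mul_pow, Real.sq_sqrt (by positivity)]
  calc _ ≤ ∑ _j : Fin d, r ^ 2 := Finset.sum_le_sum fun j _ => by
        simpa using pow_le_pow_left₀ (abs_nonneg _) (he j) 2
    _ = _ := by simp [mul_comm]

lemma ae_norm_outcome_le (I : PerturbedContexts d K) (T : ℕ) (θ v : Vec d)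
    {rank : Fin K → ℕ} (hrank : Function.Injective rank) :
    ∀ᵐ z ∂(I.roundLaw.restrict (roundEvent d K (Rhat d K T I.ρ))),
      ‖(outcome θ v rank z).1‖ ≤ Rad d K T I.ρ := by
  rw [ae_restrict_iff' (measurableSet_roundEvent _)]
  filter_upwards [ae_roundLaw_of_meanLaw I I.norm_mean_le] with z hz hE
  by_cases h : ∃ a, IsSelected v rank (contexts z) a
  · obtain ⟨a, ha⟩ := h
    have hl : (z.1 a).isLeft := by simpa only [contexts_isLeft] using ha.1
    rw [outcome_of_isSelected hrank ha, vecOf_contexts z hl]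
    refine (norm_add_le _ _).trans (add_le_add (hz a _ (eq_inl_iff.2 ⟨hl, rfl⟩))
      (norm_toLp_le (Rhat_nonneg T I.ρ_pos) (hE a)))
  · rw [outcome_of_not_exists h]
    simpa using zero_le_one.trans (one_le_Rad T I.ρ_pos)

end RoundLaw

/-! ### The eigenvalue bound for a batch, given its past. -/

section Batch

variable {d K Y : ℕ} {S : Type*} [MeasurableSpace S]

/-- The batch contexts whose covariance is smaller than `R ^ 2` in some direction. -/
def lowDiversity (d n : ℕ) (R : ℝ) : Set (Fin n → Vec d) :=
  {X | ∃ u : Vec d, ‖u‖ = 1 ∧ ∑ i, inner ℝ u (X i) ^ 2 < R ^ 2}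

lemma measurableSet_lowDiversity (n : ℕ) (R : ℝ) : MeasurableSet (lowDiversity d n R) := by
  have : lowDiversity d n R = ⋃ u : Vec d, ⋃ _ : ‖u‖ = 1,
      {X : Fin n → Vec d | ∑ i, inner ℝ u (X i) ^ 2 < R ^ 2} := by
    ext; simp [lowDiversity]
  rw [this]
  -- The union over directions is uncountable, but each set in it is open.
  refine IsOpen.measurableSet (isOpen_iUnion fun u => isOpen_iUnion fun _ => ?_)
  exact isOpen_lt (by fun_prop) continuous_const

/-- The rate is `3/4 · 1/15 = 1/20` times `ρ² / (R² log T)`, while `8e² / (e - 1)²` is just above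
`20`. Hence the exponent is at least `1 + log (2d/δ)`, and the bound becomes `2δ/e ≤ δ`. The second
summand of the threshold is not needed. -/
lemma chernoff_factor_le {T : ℕ} (hd : 1 ≤ d) (hT : 4 ≤ T) {ρ δ : ℝ} (hρ : 0 < ρ) (hδ : 0 < δ)
    (hδ1 : δ < 1) (hY : Yzero d K T ρ δ ≤ Y) :
    4 * (d : ℝ) * Real.exp (-(3 / 4 * (ρ ^ 2 / (15 * Real.log T)) / Rad d K T ρ ^ 2) * Y) ≤ δ := by
  have hd' : (1 : ℝ) ≤ d := by exact_mod_cast hd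
  have hT' : (4 : ℝ) ≤ T := by exact_mod_cast hT
  have hL : 0 < Real.log T := Real.log_pos (by linarith)
  have hR := one_le_Rad (d := d) (K := K) T hρ
  set R := Rad d K T ρ
  set L := Real.log T
  set l := 1 + Real.log (2 * d / δ)
  have hl : 0 ≤ l := by
    have : 0 ≤ Real.log (2 * d / δ) := Real.log_nonneg (by rw [le_div_iff₀ hδ]; linarith)
    positivity
  have hl2 : 0 ≤ Real.log (2 / δ) := Real.log_nonneg (by rw [le_div_iff₀ hδ]; linarith)
  have he1 := Real.exp_one_gt_d9
  have he2 := Real.exp_one_lt_d9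
  set e := Real.exp 1
  have hc : 20 ≤ 8 * e ^ 2 / (e - 1) ^ 2 := by
    rw [le_div_iff₀ (by nlinarith)]
    nlinarith
  have hY' : (R / ρ) ^ 2 * 20 * l * L ≤ Y := by
    refine le_trans ?_ hY
    have h1 : 0 ≤ 4 * e / (e - 1) * Real.log (2 / δ) := by
      have : 0 < e - 1 := by linarith
      positivity
    have h2 : (R / ρ) ^ 2 * 20 * l * L ≤ (R / ρ) ^ 2 * (8 * e ^ 2 / (e - 1) ^ 2) * l * L := by
      gcongr
    exact h2.trans (le_add_of_nonneg_right h1)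
  have h3 : l ≤ 3 / 4 * (ρ ^ 2 / (15 * L)) / R ^ 2 * Y := by
    calc l = 3 / 4 * (ρ ^ 2 / (15 * L)) / R ^ 2 * ((R / ρ) ^ 2 * 20 * l * L) := by
          field_simp; ring
      _ ≤ _ := by gcongr
  calc _ ≤ 4 * (d : ℝ) * Real.exp (-l) := by
        gcongr
        linarith
    _ = 2 * δ / e := by
        simp only [l]
        rw [neg_add, Real.exp_add, Real.exp_neg, Real.exp_neg, Real.exp_log (by positivity)]
        simp only [e]
        field_simp
        norm_num
    _ ≤ δ := by
        rw [div_le_iff₀ (by linarith)]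
        nlinarith

lemma pi_roundLaw_lowDiversity_le (I : PerturbedContexts d K) {T : ℕ} (hd : 1 ≤ d)
    (hK : 1 ≤ K) (hKT : 4 * K ≤ T) {δ : ℝ} (hδ : 0 < δ) (hY : Yzero d K T I.ρ δ ≤ Y)
    (θ : Vec d) (v : Fin Y → Vec d) {rank : Fin Y → Fin K → ℕ}
    (hrank : ∀ i, Function.Injective (rank i)) :
    (Measure.pi fun _ : Fin Y => I.roundLaw)
        ((Set.univ.pi fun _ => roundEvent d K (Rhat d K T I.ρ)) ∩
          {Z | (fun i => (outcome θ (v i) (rank i) (Z i)).1) ∈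
            lowDiversity d Y (Rad d K T I.ρ)}) ≤
      ENNReal.ofReal δ * (Measure.pi fun _ : Fin Y => I.roundLaw)
        (Set.univ.pi fun _ => roundEvent d K (Rhat d K T I.ρ)) := by
  set E := roundEvent d K (Rhat d K T I.ρ)
  -- For `δ ≥ 1` the claim is monotonicity; the logarithmic estimates need `δ < 1`.
  rcases le_or_gt 1 δ with hδ1 | hδ1
  · refine (measure_mono Set.inter_subset_left).trans (le_mul_of_one_le_left (zero_le) ?_)
    rwa [← ENNReal.ofReal_one, ENNReal.ofReal_le_ofReal_iff hδ.le]
  have hE : MeasurableSet E := measurableSet_roundEvent _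
  have hT4 : (4 : ℝ) ≤ T := by exact_mod_cast (by omega : 4 ≤ T)
  have hL : 0 < Real.log T := Real.log_pos (by linarith)
  have hR := one_le_Rad (d := d) (K := K) T I.ρ_pos
  set lam := I.ρ ^ 2 / (15 * Real.log T)
  have hlam : 0 ≤ lam := by positivity
  have h1 := measure_exists_sum_inner_sq_lt_le (d := d) (R := Rad d K T I.ρ) (by linarith)
    (I.roundLaw.restrict E) hlam Y (x := fun i z => (outcome θ (v i) (rank i) z).1)
    (fun i => measurable_fst.comp (measurable_outcome_round θ (v i) (hrank i)))
    (fun i => ae_norm_outcome_le I T θ (v i) (hrank i))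
    (fun i w hw => by
      refine le_trans ?_ (setLIntegral_inner_outcome_sq_ge I hd hK hKT θ (v i) hw (hrank i))
      refine mul_le_of_le_one_right zero_le ?_
      rw [Measure.restrict_apply_univ]
      exact prob_le_one)
  rw [← Measure.restrict_pi_pi, Measure.restrict_apply' (MeasurableSet.univ_pi fun _ => hE),
    Measure.restrict_apply_univ] at h1
  rw [Set.inter_comm]
  refine h1.trans ?_
  rw [Measure.pi_pi, Finset.prod_const, Finset.card_univ, Fintype.card_fin, mul_pow, ← mul_assoc]
  refine mul_le_mul_left ?_ _
  have h2 : ENNReal.ofReal (1 - 3 / 4 * lam / Rad d K T I.ρ ^ 2) ^ Y ≤ ENNReal.ofReal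
      (Real.exp (-(3 / 4 * lam / Rad d K T I.ρ ^ 2) * Y)) := by
    rw [mul_comm _ (Y : ℝ), Real.exp_nat_mul, ENNReal.ofReal_pow (Real.exp_pos _).le]
    gcongr
    have := Real.add_one_le_exp (-(3 / 4 * lam / Rad d K T I.ρ ^ 2))
    linarith
  calc _ ≤ 4 * (d : ENNReal) * ENNReal.ofReal
        (Real.exp (-(3 / 4 * lam / Rad d K T I.ρ ^ 2) * Y)) := mul_le_mul_right h2 _
    _ = ENNReal.ofReal (4 * (d : ℝ) *
        Real.exp (-(3 / 4 * lam / Rad d K T I.ρ ^ 2) * Y)) := by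
      rw [ENNReal.ofReal_mul (by positivity), ENNReal.ofReal_mul (by norm_num)]
      simp
    _ ≤ _ := ENNReal.ofReal_le_ofReal (chernoff_factor_le hd (by omega) I.ρ_pos hδ hδ1 hY)

lemma boundedPerturbations_eq {S : Type*} (b : ℕ) (r : ℝ) :
    boundedPerturbations d K Y S b r =
      splitBatch (b * Y) Y ⁻¹' (Set.univ ×ˢ Set.univ.pi fun _ => roundEvent d K r) := by
  ext ω
  simp only [Set.mem_preimage, Set.mem_prod, Set.mem_univ, true_and, Set.mem_univ_pi]
  rfl

lemma measurable_splitBatch (n : ℕ) :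
    Measurable (splitBatch n Y : S × (ℕ → RoundData d K) → _) := by
  unfold splitBatch
  fun_prop

lemma measurableSet_boundedPerturbations (b : ℕ) (r : ℝ) :
    MeasurableSet (boundedPerturbations d K Y S b r) := by
  rw [boundedPerturbations_eq]
  exact measurable_splitBatch _ (MeasurableSet.univ.prod
    (MeasurableSet.univ_pi fun _ => measurableSet_roundEvent r))

/-- Data diversity of a batch, in integrated form. -/
theorem runLaw_inter_lowDiversity_le (I : PerturbedContexts d K) (alg : BatchGreedy d K Y S)
    {T : ℕ} (hd : 1 ≤ d) (hK : 1 ≤ K) (hKT : 4 * K ≤ T) {δ : ℝ} (hδ : 0 < δ)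
    (hY : Yzero d K T I.ρ δ ≤ Y) (θ : Vec d) (b : ℕ)
    {A : Set (Fin (b * Y) → Vec d × ℝ)} (hA : MeasurableSet A) :
    runLaw I alg (boundedPerturbations d K Y S b (Rhat d K T I.ρ) ∩
        ((fun ω => history alg θ ω (b * Y)) ⁻¹' A) ∩
        batchContexts alg θ b ⁻¹' lowDiversity d Y (Rad d K T I.ρ)) ≤
      ENNReal.ofReal δ * runLaw I alg (boundedPerturbations d K Y S b (Rhat d K T I.ρ) ∩
        ((fun ω => history alg θ ω (b * Y)) ⁻¹' A)) := by
  have := alg.isProb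
  have hmp := measurePreserving_splitBatch I alg (b * Y) Y
  set E := Set.univ.pi fun _ : Fin Y => roundEvent d K (Rhat d K T I.ρ)
  have hE : MeasurableSet E := MeasurableSet.univ_pi fun _ => measurableSet_roundEvent _
  set A' : Set (S × (Fin (b * Y) → RoundData d K)) :=
    {u | history alg θ (extendPast u) (b * Y) ∈ A}
  have hA' : MeasurableSet A' :=
    ((measurable_history alg θ (b * Y)).comp measurable_extendPast) hA
  set D : Set ((S × (Fin (b * Y) → RoundData d K)) × (Fin Y → RoundData d K)) :=
    {p | (fun i => (batchOutcome alg θ b i p.1 (p.2 i)).1) ∈ lowDiversity d Y (Rad d K T I.ρ)}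
  have hD : MeasurableSet D := by
    refine measurableSet_preimage (f := fun p : (S × (Fin (b * Y) → RoundData d K)) ×
      (Fin Y → RoundData d K) => fun i => (batchOutcome alg θ b i p.1 (p.2 i)).1)
      (measurable_pi_iff.2 fun i => ?_) (measurableSet_lowDiversity _ _)
    exact measurable_fst.comp ((measurable_batchOutcome alg θ b i).comp
      (measurable_fst.prodMk ((measurable_pi_apply i).comp measurable_snd)))
  have h1 : boundedPerturbations d K Y S b (Rhat d K T I.ρ) ∩
      ((fun ω => history alg θ ω (b * Y)) ⁻¹' A) = splitBatch (b * Y) Y ⁻¹' (A' ×ˢ E) := by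
    rw [boundedPerturbations_eq]
    ext ω
    simp only [Set.mem_inter_iff, Set.mem_preimage, Set.mem_prod, Set.mem_univ, true_and, A']
    change _ ∧ _ ↔ history alg θ (extendPast (splitBatch (b * Y) Y ω).1) (b * Y) ∈ A ∧ _
    rw [history_extendPast alg θ (b * Y) ω le_rfl, and_comm]
  have h2 : batchContexts alg θ b ⁻¹' lowDiversity d Y (Rad d K T I.ρ) =
      splitBatch (b * Y) Y ⁻¹' D := by
    ext ω
    change (fun i => (batchHistory alg θ b ω i).1) ∈ lowDiversity d Y (Rad d K T I.ρ) ↔ _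
    simp only [batchHistory_eq]
    rfl
  rw [h1, h2, ← Set.preimage_inter,
    hmp.measure_preimage ((hA'.prod hE).inter hD).nullMeasurableSet,
    hmp.measure_preimage (hA'.prod hE).nullMeasurableSet,
    Measure.prod_apply ((hA'.prod hE).inter hD), Measure.prod_prod,
    mul_comm (Measure.prod _ _ A'), ← mul_assoc, ← setLIntegral_const, ← lintegral_indicator hA']
  -- For fixed past `u` the estimates and ranks are constants, so the bound for independent rounds
  -- applies on `A'`; off `A'` both sides vanish.
  refine lintegral_mono fun u => ?_
  by_cases hu : u ∈ A'
  · rw [Set.indicator_of_mem hu]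
    refine le_trans (measure_mono ?_) (pi_roundLaw_lowDiversity_le I hd hK hKT hδ hY θ
      (fun i => alg.estimate (b * Y + i) u.1 (pastPairs alg θ b i u))
      (rank := fun i => alg.rank (b * Y + i) u.1 (pastPairs alg θ b i u))
      (fun i => alg.rank_injective _ _ _))
    exact fun Z hZ => ⟨hZ.1.2, hZ.2⟩
  · rw [Set.indicator_of_notMem hu]
    refine le_of_eq (measure_mono_null (t := ∅) ?_ measure_empty)
    exact fun Z hZ => hu hZ.1.1

end Batch

/-! ### The smallest eigenvalue as a minimum over directions. -/

section LambdaMin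

variable {d n : ℕ}

/-- The sum of the rank one matrices of a family of vectors. -/
noncomputable def gram (X : Fin n → Vec d) : Matrix (Fin d) (Fin d) ℝ :=
  ∑ i, Matrix.vecMulVec (X i) (X i)

lemma gram_isHermitian (X : Fin n → Vec d) : (gram X).IsHermitian := by
  rw [gram, Matrix.IsHermitian, Matrix.conjTranspose_sum]
  refine Finset.sum_congr rfl fun i _ => ?_
  ext a b
  simp [Matrix.vecMulVec_apply, mul_comm]

lemma gram_mulVec (X : Fin n → Vec d) (u : Vec d) :
    gram X *ᵥ u.ofLp = (∑ i, inner ℝ (X i) u • X i).ofLp := by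
  ext j
  simp only [gram, Matrix.sum_mulVec, Matrix.vecMulVec_mulVec, Finset.sum_apply, Pi.smul_apply,
    MulOpposite.smul_eq_mul_unop, MulOpposite.unop_op, WithLp.ofLp_sum, WithLp.ofLp_smul,
    smul_eq_mul]
  refine Finset.sum_congr rfl fun i _ => ?_
  rw [mul_comm, PiLp.inner_apply]
  simp [dotProduct, mul_comm]

lemma dotProduct_gram_mulVec (X : Fin n → Vec d) (u : Vec d) :
    u.ofLp ⬝ᵥ gram X *ᵥ u.ofLp = ∑ i, inner ℝ u (X i) ^ 2 := by
  have h : ∀ y : Vec d, u.ofLp ⬝ᵥ y.ofLp = inner ℝ u y := by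
    intro y; rw [PiLp.inner_apply]; simp [dotProduct, mul_comm]
  rw [gram_mulVec, h, inner_sum]
  refine Finset.sum_congr rfl fun i _ => ?_
  rw [inner_smul_right, real_inner_comm, sq]

/-- Forward, subtracting `r` times the identity shifts the spectrum, so the difference is positive
semidefinite. Backward, test with unit eigenvectors. The dimension must be positive, since `sInf ∅`
is a default value. -/
lemma le_lambdaMin_gram_iff (hd : 1 ≤ d) (X : Fin n → Vec d) (r : ℝ) :
    r ≤ lambdaMin (gram X) ↔ ∀ u : Vec d, ‖u‖ = 1 → r ≤ ∑ i, inner ℝ u (X i) ^ 2 := by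
  have hA := gram_isHermitian X
  have hspec := hA.spectrum_real_eq_range_eigenvalues
  have hdot : ∀ u : Vec d, u.ofLp ⬝ᵥ u.ofLp = ‖u‖ ^ 2 := by
    intro u
    rw [EuclideanSpace.norm_sq_eq, dotProduct]
    exact Finset.sum_congr rfl fun j _ => by simp [sq]
  constructor
  · intro hr u hu
    have hB : (gram X - r • (1 : Matrix (Fin d) (Fin d) ℝ)).IsHermitian := by
      refine hA.sub ?_
      rw [Matrix.IsHermitian, Matrix.conjTranspose_smul]
      simp
    have hps : (gram X - r • (1 : Matrix (Fin d) (Fin d) ℝ)).PosSemidef := by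
      rw [hB.posSemidef_iff_eigenvalues_nonneg]
      intro i
      have h1 := hB.eigenvalues_mem_spectrum_real i
      have h2 : hB.eigenvalues i + r ∈ spectrum ℝ (gram X) := by
        have h3 := spectrum.add_mem_add_iff (R := ℝ) (a := gram X - r • 1) (r := hB.eigenvalues i)
          (s := r)
        rw [Algebra.algebraMap_eq_smul_one, add_sub_cancel] at h3
        exact h3.2 h1
      have h4 : lambdaMin (gram X) ≤ hB.eigenvalues i + r :=
        csInf_le (by rw [hspec]; exact (Set.finite_range _).bddBelow) h2
      change 0 ≤ _
      linarith
    have h5 := (Matrix.posSemidef_iff_dotProduct_mulVec.1 hps).2 u.ofLp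
    rw [Matrix.sub_mulVec, Matrix.smul_mulVec, Matrix.one_mulVec, dotProduct_sub,
      dotProduct_smul] at h5
    simp only [star_trivial] at h5
    rw [dotProduct_gram_mulVec, hdot, hu] at h5
    simp only [smul_eq_mul] at h5
    linarith
  · intro h
    have : Nonempty (Fin d) := ⟨⟨0, hd⟩⟩
    refine le_csInf (by rw [hspec]; exact Set.range_nonempty _) ?_
    rw [hspec]
    rintro _ ⟨i, rfl⟩
    have h1 : ‖hA.eigenvectorBasis i‖ = 1 := hA.eigenvectorBasis.orthonormal.1 i
    have h2 := h _ h1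
    rw [← dotProduct_gram_mulVec, hA.mulVec_eigenvectorBasis, dotProduct_smul, hdot, h1] at h2
    simpa using h2

lemma sq_le_lambdaMin_gram_iff (hd : 1 ≤ d) (X : Fin n → Vec d) (R : ℝ) :
    R ^ 2 ≤ lambdaMin (gram X) ↔ X ∉ lowDiversity d n R := by
  rw [le_lambdaMin_gram_iff hd]
  change _ ↔ ¬ ∃ u : Vec d, ‖u‖ = 1 ∧ ∑ i, inner ℝ u (X i) ^ 2 < R ^ 2
  push Not
  rfl

end LambdaMin

/-! ### From integrated bounds to conditional probabilities. -/

section CondExp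

variable {Ω E : Type*} [MeasurableSpace Ω] [MeasurableSpace E]

/-- A lower bound of the conditional probability of an event from its integrated form. -/
lemma ae_cond_le_condExp_of_compl {P : Measure Ω} [IsProbabilityMeasure P] {B G : Set Ω}
    (hB : MeasurableSet B) (hG : MeasurableSet G) {H : Ω → E} (hH : Measurable H) {δ : ℝ}
    (hδ : 0 ≤ δ)
    (h : ∀ A : Set E, MeasurableSet A → P (B ∩ H ⁻¹' A ∩ Gᶜ) ≤
      ENNReal.ofReal δ * P (B ∩ H ⁻¹' A)) :
    ∀ᵐ ω ∂(ProbabilityTheory.cond P B), 1 - δ ≤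
      condExp (MeasurableSpace.comap H inferInstance) (ProbabilityTheory.cond P B)
        (G.indicator fun _ => (1 : ℝ)) ω := by
  -- Conditioning on a null event gives the zero measure, and the claim is vacuous.
  by_cases h0 : P B = 0
  · have : ProbabilityTheory.cond P B = 0 := by
      rw [ProbabilityTheory.cond, Measure.restrict_eq_zero.2 h0, smul_zero]
    rw [this, ae_zero]
    exact Filter.eventually_bot
  have hprob := cond_isProbabilityMeasure h0
  set μ := ProbabilityTheory.cond P B
  have hm := hH.comap_le
  have hint : Integrable (G.indicator fun _ => (1 : ℝ)) μ :=
    (integrable_const 1).indicator hG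
  -- Both sides are measurable for the σ-algebra of `H`, so it is enough to compare integrals over
  -- the sets `H ⁻¹' A`.
  refine ae_of_ae_trim hm (ae_le_of_forall_setIntegral_le (integrable_const _)
    (integrable_condExp.trim hm stronglyMeasurable_condExp) fun s hs _ => ?_)
  obtain ⟨A, hA, rfl⟩ := hs
  have hs' : MeasurableSet (H ⁻¹' A) := hH hA
  have hsm : MeasurableSet[MeasurableSpace.comap H inferInstance] (H ⁻¹' A) := ⟨A, hA, rfl⟩
  rw [← setIntegral_trim hm stronglyMeasurable_condExp hsm, setIntegral_condExp hm hint hsm,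
    ← setIntegral_trim hm stronglyMeasurable_const hsm, setIntegral_const,
    setIntegral_indicator hG, setIntegral_const]
  simp only [smul_eq_mul, mul_one]
  have h1 : μ (H ⁻¹' A ∩ Gᶜ) ≤ ENNReal.ofReal δ * μ (H ⁻¹' A) := by
    simp only [μ]
    rw [cond_apply hB, cond_apply hB, ← Set.inter_assoc, mul_left_comm]
    exact mul_le_mul_right (h A hA) _
  have h2 : μ.real (H ⁻¹' A ∩ Gᶜ) ≤ δ * μ.real (H ⁻¹' A) := by
    have := ENNReal.toReal_mono (ENNReal.mul_ne_top ENNReal.ofReal_ne_top (measure_ne_top _ _)) h1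
    rwa [ENNReal.toReal_mul, ENNReal.toReal_ofReal hδ] at this
  have h3 := measureReal_inter_add_sdiff (μ := μ) (s := H ⁻¹' A) hG
  rw [Set.sdiff_eq] at h3
  linarith

end CondExp

/-! ### Conditional data diversity. -/

section DiversityTheorem

variable {d K Y : ℕ} {S : Type*} [MeasurableSpace S]

lemma batchCovariance_eq_gram (alg : BatchGreedy d K Y S) (θ : Vec d) (b : ℕ)
    (ω : S × (ℕ → RoundData d K)) :
    batchCovariance alg θ b ω = gram (batchContexts alg θ b ω) := rfl

lemma compl_le_lambdaMin_eq (alg : BatchGreedy d K Y S) (θ : Vec d) (b : ℕ) (hd : 1 ≤ d)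
    (R : ℝ) :
    {ω | R ^ 2 ≤ lambdaMin (batchCovariance alg θ b ω)}ᶜ =
      batchContexts alg θ b ⁻¹' lowDiversity d Y R := by
  ext ω
  simp only [batchCovariance_eq_gram, Set.mem_compl_iff, Set.mem_preimage]
  change ¬ (R ^ 2 ≤ _) ↔ _
  rw [sq_le_lambdaMin_gram_iff hd, not_not]

theorem ae_cond_le_condExp_lambdaMin (I : PerturbedContexts d K) (alg : BatchGreedy d K Y S)
    {T : ℕ} (hd : 1 ≤ d) (hK : 1 ≤ K) (hKT : 4 * K ≤ T) {δ : ℝ} (hδ : 0 < δ)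
    (hY : Yzero d K T I.ρ δ ≤ Y) (θ : Vec d) (b : ℕ) :
    ∀ᵐ ω ∂(ProbabilityTheory.cond (runLaw I alg) (boundedPerturbations d K Y S b (Rhat d K T I.ρ))),
      1 - δ ≤ condExp (MeasurableSpace.comap (fun ω' => history alg θ ω' (b * Y)) inferInstance)
        (ProbabilityTheory.cond (runLaw I alg) (boundedPerturbations d K Y S b (Rhat d K T I.ρ)))
        (Set.indicator {ω' | Rad d K T I.ρ ^ 2 ≤ lambdaMin (batchCovariance alg θ b ω')}
          fun _ => (1 : ℝ)) ω := by
  have hG : MeasurableSet {ω | Rad d K T I.ρ ^ 2 ≤ lambdaMin (batchCovariance alg θ b ω)} := by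
    refine MeasurableSet.of_compl ?_
    rw [compl_le_lambdaMin_eq alg θ b hd]
    exact measurable_batchContexts alg θ b (measurableSet_lowDiversity _ _)
  refine ae_cond_le_condExp_of_compl (measurableSet_boundedPerturbations b _) hG
    (measurable_history alg θ (b * Y)) hδ.le fun A hA => ?_
  rw [compl_le_lambdaMin_eq alg θ b hd]
  exact runLaw_inter_lowDiversity_le I alg hd hK hKT hδ hY θ b hA

end DiversityTheorem

/-! ### Unit-norm weights that reproduce a context vector. -/

section Weights

variable {d n : ℕ}

/-- The solution `p` of `gram X p = x`. -/
noncomputable def dualVec (X : Fin n → Vec d) (x : Vec d) : Vec d :=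
  WithLp.toLp 2 ((gram X)⁻¹ *ᵥ x.ofLp)

/-- The least squares weights that express `x` as a combination of the vectors `X i`. -/
noncomputable def leastSquares (X : Fin n → Vec d) (x : Vec d) (i : Fin n) : ℝ :=
  inner ℝ (X i) (dualVec X x)

/-- The projection of the `k`-th basis vector to the linear relations between the vectors
`X i`. -/
noncomputable def relation (X : Fin n → Vec d) (k i : Fin n) : ℝ :=
  (if i = k then 1 else 0) - leastSquares X (X k) i

open Classical in
/-- Weights with sum of squares `1` that express `x` as a combination of the vectors `X i`. -/
noncomputable def simWeights (X : Fin n → Vec d) (x : Vec d) (i : Fin n) : ℝ :=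
  leastSquares X x i + ∑ k, if relation X k ≠ 0 ∧ ∀ l < k, relation X l = 0 then
    √(1 - ∑ j, leastSquares X x j ^ 2) / √(∑ j, relation X k j ^ 2) * relation X k i else 0

lemma det_gram_ne_zero {R : ℝ} (hR : 0 < R) {X : Fin n → Vec d} (hX : X ∉ lowDiversity d n R) :
    (gram X).det ≠ 0 := by
  intro h
  obtain ⟨v, hv, h0⟩ := Matrix.exists_mulVec_eq_zero_iff.2 h
  set u : Vec d := WithLp.toLp 2 v
  have hu : u ≠ 0 := by
    intro h; exact hv (by simpa [u] using congrArg WithLp.ofLp h)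
  refine hX ⟨‖u‖⁻¹ • u, norm_smul_inv_norm hu, ?_⟩
  rw [← dotProduct_gram_mulVec, WithLp.ofLp_smul, Matrix.mulVec_smul]
  change (‖u‖⁻¹ • v) ⬝ᵥ ‖u‖⁻¹ • gram X *ᵥ v < R ^ 2
  rw [h0]
  simpa using by positivity

lemma sum_leastSquares_smul {X : Fin n → Vec d} (hX : (gram X).det ≠ 0) (x : Vec d) :
    ∑ i, leastSquares X x i • X i = x := by
  have h := gram_mulVec X (dualVec X x)
  rw [dualVec, WithLp.ofLp_toLp, Matrix.mulVec_mulVec,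
    Matrix.mul_nonsing_inv _ (isUnit_iff_ne_zero.2 hX), Matrix.one_mulVec] at h
  exact (WithLp.ofLp_injective 2 h).symm

lemma sum_relation_smul {X : Fin n → Vec d} (hX : (gram X).det ≠ 0) (k : Fin n) :
    ∑ i, relation X k i • X i = 0 := by
  simp only [relation, sub_smul, Finset.sum_sub_distrib, sum_leastSquares_smul hX]
  simp

lemma sum_relation_mul_leastSquares {X : Fin n → Vec d} (hX : (gram X).det ≠ 0) (k : Fin n)
    (x : Vec d) : ∑ i, leastSquares X x i * relation X k i = 0 := by
  have h := congrArg (fun y => inner ℝ y (dualVec X x)) (sum_relation_smul hX k)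
  simp only [sum_inner, real_inner_smul_left, inner_zero_left] at h
  rw [← h]
  exact Finset.sum_congr rfl fun i _ => mul_comm _ _

/-- With `p` the dual vector, the sum of squares equals `⟪x, p⟫ ≤ R ‖p‖`, and diversity in the
direction of `p` bounds it below by `R² ‖p‖²`. Hence `R ‖p‖ ≤ 1`. -/
lemma sum_leastSquares_sq_le {R : ℝ} (hR : 0 < R) {X : Fin n → Vec d}
    (hX : X ∉ lowDiversity d n R) {x : Vec d} (hx : ‖x‖ ≤ R) :
    ∑ i, leastSquares X x i ^ 2 ≤ 1 := by
  have hdet := det_gram_ne_zero hR hX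
  set p := dualVec X x
  have h1 : ∑ i, leastSquares X x i ^ 2 = inner ℝ x p := by
    have h := congrArg (fun y => inner ℝ y p) (sum_leastSquares_smul hdet x)
    simp only [sum_inner, real_inner_smul_left] at h
    rw [← h]
    exact Finset.sum_congr rfl fun i _ => by rw [sq]; rfl
  have h2 : R ^ 2 * ‖p‖ ^ 2 ≤ ∑ i, leastSquares X x i ^ 2 := by
    rcases eq_or_ne p 0 with hp | hp
    · rw [hp]; simpa using Finset.sum_nonneg fun i _ => sq_nonneg (leastSquares X x i)
    have hX' : ¬ (∑ i, inner ℝ (‖p‖⁻¹ • p) (X i) ^ 2 < R ^ 2) := fun h =>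
      hX ⟨_, norm_smul_inv_norm hp, h⟩
    have hp' : 0 < ‖p‖ := norm_pos_iff.2 hp
    simp only [real_inner_smul_left, mul_pow, ← Finset.mul_sum, not_lt] at hX'
    have h3 : ∑ i, inner ℝ p (X i) ^ 2 = ∑ i, leastSquares X x i ^ 2 :=
      Finset.sum_congr rfl fun i _ => by rw [real_inner_comm]; rfl
    rw [h3, inv_pow, inv_mul_eq_div, le_div_iff₀ (by positivity)] at hX'
    exact hX'
  have h3 : inner ℝ x p ≤ R * ‖p‖ :=
    (real_inner_le_norm x p).trans (mul_le_mul_of_nonneg_right hx (norm_nonneg _))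
  rw [h1] at h2 ⊢
  have hp := norm_nonneg p
  nlinarith [sq_nonneg (R * ‖p‖ - 1)]

/-- If all relations vanished, the vectors `dualVec X (X k)` would be a dual system to `X`, making
more than `d` vectors linearly independent. -/
lemma exists_relation_ne_zero (hn : d < n) (X : Fin n → Vec d) : ∃ k, relation X k ≠ 0 := by
  by_contra! h
  have hli : LinearIndependent ℝ X := by
    rw [Fintype.linearIndependent_iff]
    intro g hg k
    have h1 := congrArg (fun y => inner ℝ y (dualVec X (X k))) hg
    simp only [sum_inner, real_inner_smul_left, inner_zero_left] at h1
    rw [← h1]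
    have h2 : ∀ i, inner ℝ (X i) (dualVec X (X k)) = if i = k then (1 : ℝ) else 0 := by
      intro i
      have := congrFun (h k) i
      simp only [relation, leastSquares, Pi.zero_apply] at this
      linarith
    simp [h2]
  have := hli.fintype_card_le_finrank
  simp at this
  omega

/-- A relation is orthogonal to the least squares weights and does not change the represented
vector, so Pythagoras determines the multiple that fills the sum of squares up to `1`. Taking the
first nonzero relation makes the choice measurable. -/
lemma simWeights_spec {R : ℝ} (hR : 0 < R) (hn : d < n) {X : Fin n → Vec d}
    (hX : X ∉ lowDiversity d n R) {x : Vec d} (hx : ‖x‖ ≤ R) :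
    ∑ i, simWeights X x i • X i = x ∧ ∑ i, simWeights X x i ^ 2 = 1 := by
  classical
  have hdet := det_gram_ne_zero hR hX
  obtain ⟨k, hk, hmin⟩ := WellFounded.has_min (wellFounded_lt (α := Fin n))
    {k | relation X k ≠ 0} (exists_relation_ne_zero hn X)
  have hk' : relation X k ≠ 0 ∧ ∀ l < k, relation X l = 0 :=
    ⟨hk, fun l hl => by by_contra h; exact hmin l h hl⟩
  set c := √(1 - ∑ j, leastSquares X x j ^ 2) / √(∑ j, relation X k j ^ 2)
  have hw : ∀ i, simWeights X x i = leastSquares X x i + c * relation X k i := by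
    intro i
    rw [simWeights, Finset.sum_eq_single k, if_pos hk']
    · intro l _ hl
      refine if_neg fun ⟨h1, h2⟩ => ?_
      rcases lt_or_gt_of_ne hl with h | h
      · exact h1 (hk'.2 l h)
      · exact hk (h2 k h)
    · simp
  have hpos : 0 < ∑ j, relation X k j ^ 2 := by
    obtain ⟨j, hj⟩ := Function.ne_iff.1 hk'.1
    exact Finset.sum_pos' (fun i _ => sq_nonneg _) ⟨j, Finset.mem_univ _, by
      have : relation X k j ≠ 0 := hj
      positivity⟩
  have hle := sum_leastSquares_sq_le hR hX hx
  have hc : c ^ 2 * ∑ j, relation X k j ^ 2 = 1 - ∑ j, leastSquares X x j ^ 2 := by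
    simp only [c]
    rw [div_pow, Real.sq_sqrt (by linarith), Real.sq_sqrt hpos.le, div_mul_cancel₀ _ hpos.ne']
  constructor
  · simp only [hw, add_smul, mul_smul, Finset.sum_add_distrib, ← Finset.smul_sum,
      sum_leastSquares_smul hdet, sum_relation_smul hdet, smul_zero, add_zero]
  · have h1 : ∀ i, simWeights X x i ^ 2 = leastSquares X x i ^ 2 +
        2 * c * (leastSquares X x i * relation X k i) + c ^ 2 * relation X k i ^ 2 := by
      intro i; rw [hw]; ring
    simp only [h1, Finset.sum_add_distrib, ← Finset.mul_sum]
    rw [sum_relation_mul_leastSquares hdet, hc]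
    ring

variable {α : Type*} [MeasurableSpace α]

lemma measurable_det {m : Type*} [Fintype m] [DecidableEq m] {A : α → Matrix m m ℝ}
    (hA : ∀ i j, Measurable fun a => A a i j) : Measurable fun a => (A a).det := by
  simp only [Matrix.det_apply]
  exact Finset.measurable_fun_sum _ fun σ _ => Measurable.const_smul
    (Finset.measurable_fun_prod _ fun i _ => hA _ _) _

lemma measurable_leastSquares {X : α → Fin n → Vec d} (hX : Measurable X) {x : α → Vec d}
    (hx : Measurable x) (i : Fin n) : Measurable fun a => leastSquares (X a) (x a) i := by
  have hg : ∀ k l, Measurable fun a => gram (X a) k l := by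
    intro k l
    simp only [gram, Matrix.sum_apply, Matrix.vecMulVec_apply]
    fun_prop
  have hdet : Measurable fun a => Ring.inverse (gram (X a)).det := by
    simp only [Ring.inverse_eq_inv']
    exact (measurable_det hg).inv
  -- The inverse matrix is handled through determinants and the adjugate, whose entries are
  -- polynomial.
  have hadj : ∀ k l, Measurable fun a => (gram (X a)).adjugate k l := by
    intro k l
    simp only [Matrix.adjugate_apply]
    refine measurable_det fun i j => ?_
    simp only [Matrix.updateRow_apply]
    split_ifs
    · exact measurable_const
    · exact hg i j
  have hd : Measurable fun a => dualVec (X a) (x a) := by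
    refine (WithLp.measurable_toLp 2 _).comp (measurable_pi_iff.2 fun k => ?_)
    simp only [Matrix.inv_def, Matrix.mulVec, dotProduct, Matrix.smul_apply, smul_eq_mul]
    refine Finset.measurable_fun_sum _ fun l _ => (hdet.mul (hadj k l)).mul ?_
    fun_prop
  exact ((measurable_pi_apply i).comp hX).inner hd

lemma measurable_simWeights (x : Vec d) (i : Fin n) :
    Measurable fun X : Fin n → Vec d => simWeights X x i := by
  classical
  have h1 : ∀ j, Measurable fun X : Fin n → Vec d => leastSquares X x j := fun j =>
    measurable_leastSquares measurable_id measurable_const j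
  have h2 : ∀ k j, Measurable fun X : Fin n → Vec d => relation X k j := fun k j =>
    measurable_const.sub (measurable_leastSquares measurable_id (measurable_pi_apply k) j)
  have h3 : ∀ k, MeasurableSet {X : Fin n → Vec d | relation X k = 0} := fun k =>
    measurableSet_eq_fun (measurable_pi_iff.2 (h2 k)) measurable_const
  unfold simWeights
  refine (h1 i).add (Finset.measurable_fun_sum _ fun k _ => Measurable.ite ?_ ?_ measurable_const)
  · refine (h3 k).compl.inter (MeasurableSet.congr (MeasurableSet.iInter fun l =>
      MeasurableSet.iInter fun (_ : l < k) => h3 l) ?_)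
    ext X
    simp only [Set.mem_iInter]
    rfl
  · have := h2 k i
    have h4 := Finset.measurable_fun_sum Finset.univ fun j _ => (h1 j).pow_const 2
    have h5 := Finset.measurable_fun_sum Finset.univ fun j _ => (h2 k j).pow_const 2
    exact (((measurable_const.sub h4).sqrt).div h5.sqrt).mul this

/-- The sum is a linear functional of norm `1` of a standard Gaussian vector. -/
lemma pi_gaussianReal_map_sum {c : Fin n → ℝ} (hc : ∑ i, c i ^ 2 = 1) (m : ℝ) :
    (Measure.pi fun _ : Fin n => gaussianReal 0 1).map (fun η => m + ∑ i, c i * η i) =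
      gaussianReal m 1 := by
  set C : Vec n := WithLp.toLp 2 c
  have hC : ‖C‖ = 1 := by
    rw [EuclideanSpace.norm_eq]
    simp [C, hc]
  have h1 : (stdGaussian (Vec n)).map (innerSL ℝ C) = gaussianReal 0 1 := by
    rw [IsGaussian.map_eq_gaussianReal, integral_strongDual_stdGaussian,
      variance_dual_stdGaussian, innerSL_apply_norm, hC]
    simp
  have h2 : (fun η : Fin n → ℝ => m + ∑ i, c i * η i) =
      (fun t => m + t) ∘ (innerSL ℝ C) ∘ (WithLp.toLp 2 : (Fin n → ℝ) → Vec n) := by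
    ext η
    simp [C, PiLp.inner_apply, mul_comm]
  rw [h2, ← Measure.map_map (by fun_prop) (by fun_prop), ← Measure.map_map (by fun_prop)
    (by fun_prop), map_pi_eq_stdGaussian, h1, gaussianReal_map_const_add, zero_add]

end Weights

/-! ### Independence of noises and contexts, and the conditional law of a batch. -/

section Noise

variable {d K : ℕ}

/-- The context vector of a (context, reward) pair and the noise of its reward. -/
noncomputable def splitNoise (θ : Vec d) (p : Vec d × ℝ) : Vec d × ℝ :=
  (p.1, p.2 - inner ℝ θ p.1)

lemma measurable_splitNoise (θ : Vec d) : Measurable (splitNoise θ) := by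
  unfold splitNoise; fun_prop

/-- Given means and perturbations, the selected arm `a` is determined, and the revealed noise is the
single coordinate `η a`, which is `N(0, 1)` whatever `a` is. -/
lemma roundLaw_map_splitNoise (I : PerturbedContexts d K) (θ v : Vec d) {rank : Fin K → ℕ}
    (hrank : Function.Injective rank) :
    I.roundLaw.map (fun z => splitNoise θ (outcome θ v rank z)) =
      (I.roundLaw.map fun z => (outcome θ v rank z).1).prod (gaussianReal 0 1) := by
  have ho := measurable_outcome_round θ v hrank
  have hs : Measurable fun z => splitNoise θ (outcome θ v rank z) :=
    (measurable_splitNoise θ).comp ho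
  ext s hms
  rw [Measure.map_apply hs hms, Measure.prod_apply hms, lintegral_map
    (g := fun z => (outcome θ v rank z).1) (measurable_measure_prodMk_left hms)
    (measurable_fst.comp ho),
    ← lintegral_indicator_one (hs hms),
    lintegral_roundLaw I (measurable_one.indicator (hs hms)),
    lintegral_roundLaw I
      (F := fun z => (gaussianReal 0 1) (Prod.mk (outcome θ v rank z).1 ⁻¹' s))
      ((measurable_measure_prodMk_left hms).comp (measurable_fst.comp ho))]
  refine lintegral_congr_ae ?_
  filter_upwards [ae_exists_isLeft I] with m hm
  refine lintegral_congr fun ε => ?_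
  obtain ⟨a, ha⟩ := exists_isSelected v rank (c := contexts ((m, ε, 0) : RoundData d K))
    (by simpa only [contexts_isLeft] using hm)
  have hout : ∀ η : Fin K → ℝ, outcome θ v rank (m, ε, η) =
      (chosen v rank m ε, inner ℝ θ (chosen v rank m ε) + η a) := by
    intro η
    have ha' : IsSelected v rank (contexts ((m, ε, η) : RoundData d K)) a := ha
    rw [chosen_of_isSelected hrank ha, outcome_of_isSelected hrank ha',
      vecOf_contexts _ (a := a) (by simpa only [contexts_isLeft] using ha.1)]
  have h1 : ∀ η : Fin K → ℝ, ((fun z => splitNoise θ (outcome θ v rank z)) ⁻¹' s).indicator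
      (1 : RoundData d K → ENNReal) (m, ε, η) =
      (Prod.mk (chosen v rank m ε) ⁻¹' s).indicator 1 (η a) := by
    intro η
    have hmem : (m, ε, η) ∈ (fun z => splitNoise θ (outcome θ v rank z)) ⁻¹' s ↔
        η a ∈ Prod.mk (chosen v rank m ε) ⁻¹' s := by
      change splitNoise θ (outcome θ v rank (m, ε, η)) ∈ s ↔ (chosen v rank m ε, η a) ∈ s
      simp only [hout, splitNoise, add_sub_cancel_left]
    by_cases h : η a ∈ Prod.mk (chosen v rank m ε) ⁻¹' s
    · rw [Set.indicator_of_mem h, Set.indicator_of_mem (hmem.2 h)]; rfl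
    · rw [Set.indicator_of_notMem h, Set.indicator_of_notMem (fun h' => h (hmem.1 h'))]
  simp only [h1, hout, lintegral_const, measure_univ, mul_one]
  have hsec : MeasurableSet (Prod.mk (chosen v rank m ε) ⁻¹' s) := measurable_prodMk_left hms
  rw [(measurePreserving_eval (fun _ : Fin K => gaussianReal 0 1) a).lintegral_comp
    (measurable_one.indicator hsec), lintegral_indicator_one hsec]

variable {Y : ℕ} {S : Type*} [MeasurableSpace S]

lemma pi_roundLaw_map_splitNoise (I : PerturbedContexts d K) (θ : Vec d) (v : Fin Y → Vec d)
    {rank : Fin Y → Fin K → ℕ} (hrank : ∀ i, Function.Injective (rank i)) :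
    (Measure.pi fun _ : Fin Y => I.roundLaw).map (fun Z =>
        (fun i => (outcome θ (v i) (rank i) (Z i)).1,
          fun i => (splitNoise θ (outcome θ (v i) (rank i) (Z i))).2)) =
      ((Measure.pi fun _ : Fin Y => I.roundLaw).map
        fun Z i => (outcome θ (v i) (rank i) (Z i)).1).prod
        (Measure.pi fun _ : Fin Y => gaussianReal 0 1) := by
  have ho := fun i => measurable_outcome_round (d := d) θ (v i) (hrank i)
  have hs : ∀ i, Measurable fun z => splitNoise θ (outcome θ (v i) (rank i) z) :=
    fun i => (measurable_splitNoise θ).comp (ho i)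
  have hp : ∀ i, IsProbabilityMeasure (I.roundLaw.map fun z => (outcome θ (v i) (rank i) z).1) :=
    fun i => Measure.isProbabilityMeasure_map (measurable_fst.comp (ho i)).aemeasurable
  have hp' : ∀ i, IsProbabilityMeasure
      (I.roundLaw.map fun z => splitNoise θ (outcome θ (v i) (rank i) z)) :=
    fun i => Measure.isProbabilityMeasure_map (hs i).aemeasurable
  have h1 := Measure.pi_map_pi (μ := fun _ : Fin Y => I.roundLaw)
    (f := fun i z => (outcome θ (v i) (rank i) z).1) (hμ := fun i => by
      have := hp i; infer_instance) (fun i => (measurable_fst.comp (ho i)).aemeasurable)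
  have h2 := Measure.pi_map_pi (μ := fun _ : Fin Y => I.roundLaw)
    (f := fun i z => splitNoise θ (outcome θ (v i) (rank i) z)) (hμ := fun i => by
      have := hp' i; infer_instance) (fun i => (hs i).aemeasurable)
  have h3 := (measurePreserving_arrowProdEquivProdArrow (Vec d) ℝ (Fin Y)
    (fun i => I.roundLaw.map fun z => (outcome θ (v i) (rank i) z).1)
    (fun _ => gaussianReal 0 1)).map_eq
  simp only [roundLaw_map_splitNoise I θ _ (hrank _)] at h2
  rw [h1, ← h3, ← h2, Measure.map_map (MeasurableEquiv.measurable _)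
    (f := fun (Z : Fin Y → RoundData d K) i => splitNoise θ (outcome θ (v i) (rank i) (Z i)))
    (measurable_pi_iff.2 fun i => (hs i).comp (measurable_pi_apply i))]
  rfl

/-- The reward noises of the chosen arms in batch number `b`. -/
noncomputable def batchNoise (alg : BatchGreedy d K Y S) (θ : Vec d) (b : ℕ)
    (ω : S × (ℕ → RoundData d K)) : Fin Y → ℝ :=
  fun i => (splitNoise θ (batchHistory alg θ b ω i)).2

lemma measurable_batchNoise (alg : BatchGreedy d K Y S) (θ : Vec d) (b : ℕ) :
    Measurable (batchNoise alg θ b) :=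
  measurable_pi_iff.2 fun i => measurable_snd.comp ((measurable_splitNoise θ).comp
    ((measurable_pi_apply i).comp (measurable_batchHistory alg θ b)))

/-- The reward noises of a batch are independent of its contexts. -/
theorem runLaw_map_batchContexts_batchNoise (I : PerturbedContexts d K)
    (alg : BatchGreedy d K Y S) (θ : Vec d) (b : ℕ) :
    (runLaw I alg).map (fun ω => (batchContexts alg θ b ω, batchNoise alg θ b ω)) =
      ((runLaw I alg).map (batchContexts alg θ b)).prod
        (Measure.pi fun _ : Fin Y => gaussianReal 0 1) := by
  have := alg.isProb
  have hmp := measurePreserving_splitBatch I alg (b * Y) Y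
  have hX := measurable_batchContexts (K := K) alg θ b
  have hN := measurable_batchNoise (K := K) alg θ b
  have ho : ∀ i, Measurable fun p : (S × (Fin (b * Y) → RoundData d K)) ×
      (Fin Y → RoundData d K) => batchOutcome alg θ b i p.1 (p.2 i) := fun i =>
    (measurable_batchOutcome alg θ b i).comp
      (measurable_fst.prodMk ((measurable_pi_apply i).comp measurable_snd))
  set X' : (S × (Fin (b * Y) → RoundData d K)) × (Fin Y → RoundData d K) → Fin Y → Vec d :=
    fun p i => (batchOutcome alg θ b i p.1 (p.2 i)).1
  set N' : (S × (Fin (b * Y) → RoundData d K)) × (Fin Y → RoundData d K) → Fin Y → ℝ :=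
    fun p i => (splitNoise θ (batchOutcome alg θ b i p.1 (p.2 i))).2
  have hX' : Measurable X' := measurable_pi_iff.2 fun i => measurable_fst.comp (ho i)
  have hN' : Measurable N' := measurable_pi_iff.2 fun i =>
    measurable_snd.comp ((measurable_splitNoise θ).comp (ho i))
  have eX : batchContexts alg θ b = X' ∘ splitBatch (b * Y) Y := by
    ext1 ω; ext1 i
    change (batchHistory alg θ b ω i).1 = _
    rw [batchHistory_eq]
    rfl
  have eN : batchNoise alg θ b = N' ∘ splitBatch (b * Y) Y := by
    ext1 ω; ext1 i
    change (splitNoise θ (batchHistory alg θ b ω i)).2 = _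
    rw [batchHistory_eq]
    rfl
  have e1 : (runLaw I alg).map (fun ω => (batchContexts alg θ b ω, batchNoise alg θ b ω)) =
      Measure.map (fun p => (X' p, N' p)) ((alg.seedLaw.prod
        (Measure.pi fun _ : Fin (b * Y) => I.roundLaw)).prod
          (Measure.pi fun _ : Fin Y => I.roundLaw)) := by
    rw [← hmp.map_eq, Measure.map_map (hX'.prodMk hN') hmp.measurable, eX, eN]
    rfl
  have e2 : (runLaw I alg).map (batchContexts alg θ b) =
      Measure.map X' ((alg.seedLaw.prod (Measure.pi fun _ : Fin (b * Y) => I.roundLaw)).prod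
          (Measure.pi fun _ : Fin Y => I.roundLaw)) := by
    rw [← hmp.map_eq, Measure.map_map hX' hmp.measurable, eX]
  rw [e1, e2]
  ext s hs
  rw [Measure.map_apply (hX'.prodMk hN') hs, Measure.prod_apply ((hX'.prodMk hN') hs),
    Measure.prod_apply hs, lintegral_map (measurable_measure_prodMk_left hs) hX',
    lintegral_prod (fun p => (Measure.pi fun _ : Fin Y => gaussianReal 0 1)
      (Prod.mk (X' p) ⁻¹' s)) ((measurable_measure_prodMk_left hs).comp hX').aemeasurable]
  -- The noise law does not depend on the past `u`, so the product structure survives averaging over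
  -- `u`.
  refine lintegral_congr fun u => ?_
  have h : (Measure.map (fun Z => (X' (u, Z), N' (u, Z)))
      (Measure.pi fun _ : Fin Y => I.roundLaw)) s =
      ((Measure.map (fun Z => X' (u, Z)) (Measure.pi fun _ : Fin Y => I.roundLaw)).prod
        (Measure.pi fun _ : Fin Y => gaussianReal 0 1)) s :=
    congrArg (fun μ => μ s) (pi_roundLaw_map_splitNoise I θ
    (fun i => alg.estimate (b * Y + i) u.1 (pastPairs alg θ b i u))
    (rank := fun i => alg.rank (b * Y + i) u.1 (pastPairs alg θ b i u))
    (fun i => alg.rank_injective _ _ _))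
  rw [Measure.map_apply (f := fun Z => (X' (u, Z), N' (u, Z)))
      ((hX'.prodMk hN').comp measurable_prodMk_left) hs,
    Measure.prod_apply hs, lintegral_map (g := fun Z => X' (u, Z))
      (measurable_measure_prodMk_left hs) (hX'.comp measurable_prodMk_left)] at h
  exact h

/-- The (context, reward) pairs with given contexts and noises. -/
noncomputable def addNoise (θ : Vec d) (p : (Fin Y → Vec d) × (Fin Y → ℝ)) :
    Fin Y → Vec d × ℝ :=
  fun i => (p.1 i, inner ℝ θ (p.1 i) + p.2 i)

lemma measurable_addNoise (θ : Vec d) :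
    Measurable (addNoise θ : (Fin Y → Vec d) × (Fin Y → ℝ) → Fin Y → Vec d × ℝ) := by
  unfold addNoise; fun_prop

/-- Independence exhibits an explicit kernel disintegrating the joint law, and such kernels are
almost surely unique. -/
lemma ae_condDistrib_batchHistory (I : PerturbedContexts d K) (alg : BatchGreedy d K Y S)
    (θ : Vec d) (b : ℕ) :
    ∀ᵐ ω ∂(runLaw I alg),
      condDistrib (batchHistory alg θ b) (batchContexts alg θ b) (runLaw I alg)
          (batchContexts alg θ b ω) =
        (Measure.pi fun _ : Fin Y => gaussianReal 0 1).map
          fun η => addNoise θ (batchContexts alg θ b ω, η) := by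
  have hX := measurable_batchContexts (K := K) alg θ b
  have hH := measurable_batchHistory (K := K) alg θ b
  have hN := measurable_batchNoise (K := K) alg θ b
  have hΦ := measurable_addNoise (d := d) (Y := Y) θ
  set κ : Kernel (Fin Y → Vec d) (Fin Y → Vec d × ℝ) :=
    (Kernel.id ×ₖ Kernel.const _ (Measure.pi fun _ : Fin Y => gaussianReal 0 1)).map (addNoise θ)
  have hκ : ∀ X, κ X = (Measure.pi fun _ : Fin Y => gaussianReal 0 1).map
      fun η => addNoise θ (X, η) := by
    intro X
    rw [Kernel.map_apply _ hΦ, Kernel.prod_apply, Kernel.id_apply, Kernel.const_apply,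
      Measure.dirac_prod, Measure.map_map hΦ measurable_prodMk_left]
    rfl
  have : IsFiniteKernel κ := Kernel.IsFiniteKernel.map _ _
  have hrec : ∀ ω, batchHistory alg θ b ω =
      addNoise θ (batchContexts alg θ b ω, batchNoise alg θ b ω) := by
    intro ω
    ext1 i
    simp [addNoise, batchContexts, batchNoise, splitNoise]
  have hjoint : (runLaw I alg).map (fun ω => (batchContexts alg θ b ω, batchHistory alg θ b ω)) =
      (runLaw I alg).map (batchContexts alg θ b) ⊗ₘ κ := by
    have e1 : (fun ω => (batchContexts alg θ b ω, batchHistory alg θ b ω)) =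
        (fun p => (p.1, addNoise θ p)) ∘
          fun ω => (batchContexts alg θ b ω, batchNoise alg θ b ω) := by
      ext1 ω
      rw [hrec]
      rfl
    rw [e1, ← Measure.map_map (measurable_fst.prodMk hΦ) (hX.prodMk hN),
      runLaw_map_batchContexts_batchNoise]
    ext s hs
    rw [Measure.map_apply (measurable_fst.prodMk hΦ) hs,
      Measure.prod_apply ((measurable_fst.prodMk hΦ) hs), Measure.compProd_apply hs]
    refine lintegral_congr fun X => ?_
    rw [hκ, Measure.map_apply (f := fun η => addNoise θ (X, η))
      (hΦ.comp measurable_prodMk_left) (measurable_prodMk_left hs)]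
    rfl
  have h := condDistrib_ae_eq_of_measure_eq_compProd_of_measurable hX hH hjoint
  filter_upwards [ae_of_ae_map hX.aemeasurable h] with ω hω
  rw [hω, hκ]

/-- The simulated reward of the context vector `x` given a batch history `h`. -/
noncomputable def simulator (x : Vec d) (h : Fin Y → Vec d × ℝ) : ℝ :=
  ∑ i, simWeights (fun j => (h j).1) x i * (h i).2

lemma measurable_simulator (x : Vec d) :
    Measurable (simulator x : (Fin Y → Vec d × ℝ) → ℝ) :=
  Finset.measurable_fun_sum _ fun i _ =>
    ((measurable_simWeights x i).comp (by fun_prop)).mul (by fun_prop)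

/-- The exceptional null set comes from identifying the whole conditional law, so it does not depend
on `x`, and all `x` are treated at once. -/
lemma ae_simulatesAt (I : PerturbedContexts d K) (alg : BatchGreedy d K Y S) (θ : Vec d)
    (b : ℕ) {R : ℝ} (hR : 0 < R) (hY : d < Y) :
    ∀ᵐ ω ∂(runLaw I alg), batchContexts alg θ b ω ∉ lowDiversity d Y R →
      SimulatesAt I alg b R simulator θ (batchContexts alg θ b ω) := by
  filter_upwards [ae_condDistrib_batchHistory I alg θ b] with ω hω hX x hx
  obtain ⟨h1, h2⟩ := simWeights_spec hR hY hX hx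
  rw [hω, Measure.map_map (f := fun η => addNoise θ (batchContexts alg θ b ω, η))
    (measurable_simulator x) ((measurable_addNoise θ).comp measurable_prodMk_left),
    ← pi_gaussianReal_map_sum h2 (inner ℝ θ x)]
  refine congrArg (fun f : (Fin Y → ℝ) → ℝ =>
    (Measure.pi fun _ : Fin Y => gaussianReal 0 1).map f) (funext fun η => ?_)
  change ∑ i, simWeights (batchContexts alg θ b ω) x i *
    (inner ℝ θ (batchContexts alg θ b ω i) + η i) = _
  simp only [mul_add, Finset.sum_add_distrib]
  congr 1
  conv_rhs => rw [← h1]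
  rw [inner_sum]
  simp only [inner_smul_right]

end Noise

/-! ### Bounds for the radius and the batch size. -/

section Numerics

variable {d K T : ℕ}

lemma Rad_eq {ρ : ℝ} : Rad d K T ρ =
    1 + ρ * (√(2 * Real.log (2 * (T : ℝ) ^ 3 * K * d)) * √(d : ℝ)) := by
  rw [Rad, Rhat, mul_assoc, div_inv_eq_mul]
  congr 6
  ring

lemma le_Rad (hd : 1 ≤ d) (hK : 1 ≤ K) (hT : 1 ≤ T) {ρ : ℝ} (hρ : 0 < ρ) :
    1 + ρ * √(d * Real.log (T * K * d)) ≤ Rad d K T ρ := by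
  have hd' : (1 : ℝ) ≤ d := by exact_mod_cast hd
  have hK' : (1 : ℝ) ≤ K := by exact_mod_cast hK
  have hT' : (1 : ℝ) ≤ T := by exact_mod_cast hT
  have h1 : (T : ℝ) * K * d ≤ 2 * (T : ℝ) ^ 3 * K * d := by
    gcongr
    nlinarith [le_self_pow₀ hT' (n := 3) (by norm_num)]
  have h2 : (1 : ℝ) ≤ T * K * d := one_le_mul_of_one_le_of_one_le
    (one_le_mul_of_one_le_of_one_le hT' hK') hd'
  have h3 : Real.log (T * K * d) ≤ Real.log (2 * (T : ℝ) ^ 3 * K * d) :=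
    Real.log_le_log (by linarith) h1
  have h4 := Real.log_nonneg h2
  rw [Rad_eq, mul_comm (d : ℝ), Real.sqrt_mul h4]
  gcongr
  linarith

lemma Rad_le (hd : 1 ≤ d) (hK : 1 ≤ K) (hT : 2 ≤ T) {ρ : ℝ} (hρ : 0 < ρ) :
    Rad d K T ρ ≤ 1 + 3 * (ρ * √(d * Real.log (T * K * d))) := by
  have hd' : (1 : ℝ) ≤ d := by exact_mod_cast hd
  have hK' : (1 : ℝ) ≤ K := by exact_mod_cast hK
  have hT' : (2 : ℝ) ≤ T := by exact_mod_cast hT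
  -- The factor `2` is absorbed by one power of `T ≥ 2`; the constant `3` then comes from `2 · 4 ≤
  -- 3²`.
  have h1 : 2 * (T : ℝ) ^ 3 * K * d ≤ (T * K * d) ^ 4 := by
    rw [mul_pow, mul_pow]
    have a := le_self_pow₀ hd' (n := 4) (by norm_num)
    have b := le_self_pow₀ hK' (n := 4) (by norm_num)
    have c : 2 * (T : ℝ) ^ 3 ≤ T ^ 4 := by
      rw [pow_succ' (T : ℝ) 3]; gcongr
    gcongr
  have h2 : Real.log (2 * (T : ℝ) ^ 3 * K * d) ≤ 4 * Real.log (T * K * d) := by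
    have := Real.log_le_log (by positivity) h1
    rwa [Real.log_pow] at this
  have h3 : √(2 * Real.log (2 * (T : ℝ) ^ 3 * K * d)) ≤ 3 * √(Real.log (T * K * d)) := by
    have h2' : (1 : ℝ) ≤ T * K * d := one_le_mul_of_one_le_of_one_le
      (one_le_mul_of_one_le_of_one_le (by linarith) hK') hd'
    have := Real.log_nonneg h2'
    refine Real.sqrt_le_iff.2 ⟨by positivity, ?_⟩
    rw [mul_pow, Real.sq_sqrt this]
    linarith
  rw [Rad_eq, Real.sqrt_mul (Nat.cast_nonneg d)]
  calc _ ≤ 1 + ρ * (3 * √(Real.log (T * K * d)) * √(d : ℝ)) := by gcongr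
    _ = _ := by ring

/-- A batch size of order `log (d T) ^ 3 / ρ ^ 2` is large enough for failure probability
`1 / (2 T ^ 3)`. -/
lemma Yzero_le (hd : 1 ≤ d) (hK : 1 ≤ K) (hKT : 4 * K ≤ T) {ρ : ℝ} (hρ : 0 < ρ)
    (hρd : ρ ≤ 1 / √(d : ℝ)) :
    Yzero d K T ρ (1 / (2 * (T : ℝ) ^ 3)) ≤ 5000 * Real.log (d * T) ^ 3 / ρ ^ 2 ∧
      (d : ℝ) < 5000 * Real.log (d * T) ^ 3 / ρ ^ 2 := by
  have hd' : (1 : ℝ) ≤ d := by exact_mod_cast hd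
  have hK' : (1 : ℝ) ≤ K := by exact_mod_cast hK
  have hT' : (4 : ℝ) ≤ T := by exact_mod_cast (by omega : 4 ≤ T)
  have hKT' : (K : ℝ) ≤ T := by exact_mod_cast (by omega : K ≤ T)
  have hd0 : 0 < √(d : ℝ) := Real.sqrt_pos.2 (by linarith)
  have hρd' : ρ * √(d : ℝ) ≤ 1 := (le_div_iff₀ hd0).1 hρd
  have hρ2 : ρ ^ 2 * d ≤ 1 := by
    have := pow_le_one₀ (n := 2) (by positivity) hρd'
    rwa [mul_pow, Real.sq_sqrt (by linarith)] at this
  have hρ1 : ρ ^ 2 ≤ 1 := by nlinarith [sq_nonneg ρ]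
  have hTd : (T : ℝ) ≤ d * T := by nlinarith
  have hl1 : 1 ≤ Real.log (d * T) := by
    rw [Real.le_log_iff_exp_le (by positivity)]
    linarith [Real.exp_one_lt_d9]
  set l := Real.log (d * T)
  have hlT : Real.log T ≤ l := Real.log_le_log (by linarith) hTd
  have hlT0 : 0 ≤ Real.log T := Real.log_nonneg (by linarith)
  have hL : Real.log (T * K * d) ≤ 2 * l := by
    have h : (T : ℝ) * K * d ≤ (d * T) ^ 2 := by
      calc (T : ℝ) * K * d ≤ T * T * (d * d) := by
            gcongr
            nlinarith
        _ = _ := by ring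
    have := Real.log_le_log (by positivity) h
    rwa [Real.log_pow] at this
  have h4 : 4 * d * (T : ℝ) ^ 3 ≤ (d * T) ^ 4 := by
    rw [mul_pow]
    have a := le_self_pow₀ hd' (n := 4) (by norm_num)
    calc 4 * d * (T : ℝ) ^ 3 ≤ T * (d : ℝ) ^ 4 * T ^ 3 := by gcongr
      _ = _ := by ring
  have hl4 : Real.log (2 * d / (1 / (2 * (T : ℝ) ^ 3))) ≤ 4 * l := by
    have h : 2 * d / (1 / (2 * (T : ℝ) ^ 3)) = 4 * d * (T : ℝ) ^ 3 := by field_simp; ring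
    rw [h]
    have := Real.log_le_log (by positivity) h4
    rwa [Real.log_pow] at this
  have hl5 : Real.log (2 / (1 / (2 * (T : ℝ) ^ 3))) ≤ 4 * l := by
    refine le_trans (Real.log_le_log (by positivity) ?_) hl4
    gcongr
    linarith
  -- As `ρ √d ≤ 1`, the radius is at most `1 + 3 √(2l)`; then `(1 + s)² ≤ 2 + 2s²` and `l ≥ 1` give
  -- `2 + 36 l ≤ 38 l`.
  have hR : Rad d K T ρ ^ 2 ≤ 38 * l := by
    have h1 := Rad_le hd hK (by omega : 2 ≤ T) hρ
    rw [Real.sqrt_mul (by positivity)] at h1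
    have h2 : √(Real.log (T * K * d)) ≤ √(2 * l) := Real.sqrt_le_sqrt hL
    have h3 : Rad d K T ρ ≤ 1 + 3 * √(2 * l) := by
      refine h1.trans ?_
      rw [← mul_assoc ρ]
      gcongr
      calc _ ≤ 1 * √(2 * l) := by gcongr
        _ = _ := one_mul _
    have h5 := pow_le_pow_left₀ (zero_le_one.trans (one_le_Rad T hρ)) h3 2
    have h6 := Real.sq_sqrt (by linarith : 0 ≤ 2 * l)
    nlinarith [sq_nonneg (1 - 3 * √(2 * l))]
  have he1 := Real.exp_one_gt_d9
  have he2 := Real.exp_one_lt_d9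
  have hc1 : 8 * Real.exp 1 ^ 2 / (Real.exp 1 - 1) ^ 2 ≤ 21 := by
    rw [div_le_iff₀ (by nlinarith)]
    nlinarith
  have hc2 : 4 * Real.exp 1 / (Real.exp 1 - 1) ≤ 7 := by
    rw [div_le_iff₀ (by linarith)]
    linarith
  have hρl : 1 ≤ 1 / ρ ^ 2 := by rw [le_div_iff₀ (by positivity)]; linarith
  have hl3 : l ≤ l ^ 3 := le_self_pow₀ hl1 (by norm_num)
  constructor
  · have hn1 : 0 ≤ Real.log (2 * d / (1 / (2 * (T : ℝ) ^ 3))) := by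
      refine Real.log_nonneg ?_
      rw [le_div_iff₀ (by positivity), one_mul, div_le_iff₀ (by positivity)]
      have : (1 : ℝ) ≤ (T : ℝ) ^ 3 := one_le_pow₀ (by linarith)
      nlinarith
    have hn2 : 0 ≤ Real.log (2 / (1 / (2 * (T : ℝ) ^ 3))) := by
      refine Real.log_nonneg ?_
      rw [le_div_iff₀ (by positivity), one_mul, div_le_iff₀ (by positivity)]
      have : (1 : ℝ) ≤ (T : ℝ) ^ 3 := one_le_pow₀ (by linarith)
      linarith
    have hn3 : 0 ≤ Real.exp 1 - 1 := by linarith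
    calc Yzero d K T ρ (1 / (2 * (T : ℝ) ^ 3))
        ≤ 38 * l / ρ ^ 2 * 21 * (1 + 4 * l) * l + 7 * (4 * l) := by
          rw [Yzero, div_pow]
          gcongr
      _ ≤ 38 * l / ρ ^ 2 * 21 * (l + 4 * l) * l + 7 * (4 * l ^ 3 * (1 / ρ ^ 2)) := by
          have h7 : l ≤ l ^ 3 * (1 / ρ ^ 2) :=
            hl3.trans (le_mul_of_one_le_right (by positivity) hρl)
          refine add_le_add (by gcongr) (by linarith)
      _ = 4018 * l ^ 3 / ρ ^ 2 := by ring
      _ ≤ _ := by gcongr; norm_num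
  -- From `ρ ≤ 1 / √d` one has `ρ² d ≤ 1`; this makes the batch longer than the dimension, as the
  -- linear relation requires.
  · rw [lt_div_iff₀ (by positivity)]
    nlinarith

end Numerics

/-! ### Union bounds over rounds and batches. -/

section Simulation

variable {d K Y T : ℕ} {S : Type*} [MeasurableSpace S]

lemma runLaw_boundedPerturbations_compl_le (I : PerturbedContexts d K)
    (alg : BatchGreedy d K Y S) (hd : 1 ≤ d) (hK : 1 ≤ K) (hT : 1 ≤ T) (b : ℕ) :
    runLaw I alg (boundedPerturbations d K Y S b (Rhat d K T I.ρ))ᶜ ≤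
      Y * ENNReal.ofReal (1 / (2 * (T : ℝ) ^ 3)) := by
  have := alg.isProb
  have hE := measurableSet_roundEvent (d := d) (K := K) (Rhat d K T I.ρ)
  have hmp := measurePreserving_splitBatch I alg (b * Y) Y
  have hev : ∀ i : Fin Y, MeasurePreserving (fun ω => (splitBatch (b * Y) Y ω).2 i)
      (runLaw I alg) I.roundLaw := fun i =>
    (measurePreserving_eval (fun _ : Fin Y => I.roundLaw) i).comp
      (measurePreserving_snd.comp hmp)
  have hsub : (boundedPerturbations d K Y S b (Rhat d K T I.ρ))ᶜ ⊆ ⋃ i : Fin Y,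
      (fun ω => (splitBatch (b * Y) Y ω).2 i) ⁻¹' (roundEvent d K (Rhat d K T I.ρ))ᶜ := by
    intro ω hω
    rw [boundedPerturbations_eq] at hω
    simpa using hω
  refine (measure_mono hsub).trans ((measure_iUnion_fintype_le _ _).trans ?_)
  calc _ ≤ ∑ _i : Fin Y, ENNReal.ofReal (1 / (2 * (T : ℝ) ^ 3)) :=
        Finset.sum_le_sum fun i _ => by
          rw [(hev i).measure_preimage hE.compl.nullMeasurableSet]
          exact roundLaw_roundEvent_compl_le I hd hK hT
    _ = _ := by simp

/-- Either one of the `Y` rounds has a large perturbation, or diversity fails on the bounded event.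
Taking `δ = 1/(2T³)` gives the latter the same failure bound as one round. -/
lemma runLaw_lowDiversity_le (I : PerturbedContexts d K) (alg : BatchGreedy d K Y S)
    (hd : 1 ≤ d) (hK : 1 ≤ K) (hKT : 4 * K ≤ T)
    (hY : Yzero d K T I.ρ (1 / (2 * (T : ℝ) ^ 3)) ≤ Y) (θ : Vec d) (b : ℕ) :
    runLaw I alg (batchContexts alg θ b ⁻¹' lowDiversity d Y (Rad d K T I.ρ)) ≤
      (Y + 1) * ENNReal.ofReal (1 / (2 * (T : ℝ) ^ 3)) := by
  have hT : (0 : ℝ) < T := by exact_mod_cast (by omega : 0 < T)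
  have h1 := runLaw_inter_lowDiversity_le I alg hd hK hKT (by positivity) hY θ b
    MeasurableSet.univ
  rw [Set.preimage_univ, Set.inter_univ] at h1
  set B := boundedPerturbations d K Y S b (Rhat d K T I.ρ)
  set D := batchContexts alg θ b ⁻¹' lowDiversity d Y (Rad d K T I.ρ)
  have hsub : D ⊆ Bᶜ ∪ B ∩ D := fun ω h => by
    by_cases hB : ω ∈ B
    exacts [Or.inr ⟨hB, h⟩, Or.inl hB]
  calc _ ≤ runLaw I alg Bᶜ + runLaw I alg (B ∩ D) :=
        (measure_mono hsub).trans (measure_union_le _ _)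
    _ ≤ Y * ENNReal.ofReal (1 / (2 * (T : ℝ) ^ 3)) + ENNReal.ofReal (1 / (2 * (T : ℝ) ^ 3)) :=
        add_le_add (runLaw_boundedPerturbations_compl_le I alg hd hK (by omega) b)
          (h1.trans (mul_le_of_le_one_right zero_le prob_le_one))
    _ = _ := by ring

theorem runLaw_not_simulatesAt_le (I : PerturbedContexts d K) (alg : BatchGreedy d K Y S)
    (hd : 1 ≤ d) (hK : 1 ≤ K) (hKT : 4 * K ≤ T) (hdY : d < Y)
    (hY : Yzero d K T I.ρ (1 / (2 * (T : ℝ) ^ 3)) ≤ Y) (θ : Vec d) :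
    runLaw I alg {ω | ¬ ∀ b : ℕ, (b + 1) * Y ≤ T →
      SimulatesAt I alg b (Rad d K T I.ρ) simulator θ (batchContexts alg θ b ω)} ≤
        ENNReal.ofReal (((T : ℝ) ^ 2)⁻¹) := by
  have hT : (0 : ℝ) < T := by exact_mod_cast (by omega : 0 < T)
  have hY1 : 1 ≤ Y := by omega
  have hae : ∀ᵐ ω ∂(runLaw I alg), ∀ b, batchContexts alg θ b ω ∉
      lowDiversity d Y (Rad d K T I.ρ) →
        SimulatesAt I alg b (Rad d K T I.ρ) simulator θ (batchContexts alg θ b ω) :=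
    ae_all_iff.2 fun b => ae_simulatesAt I alg θ b
      (zero_lt_one.trans_le (one_le_Rad T I.ρ_pos)) hdY
  have hsub : {ω | ¬ ∀ b : ℕ, (b + 1) * Y ≤ T →
      SimulatesAt I alg b (Rad d K T I.ρ) simulator θ (batchContexts alg θ b ω)} ≤ᵐ[runLaw I alg]
      ⋃ b ∈ Finset.range (T / Y), batchContexts alg θ b ⁻¹' lowDiversity d Y (Rad d K T I.ρ) := by
    filter_upwards [hae] with ω hω hbad
    change ¬ ∀ b : ℕ, (b + 1) * Y ≤ T →
      SimulatesAt I alg b (Rad d K T I.ρ) simulator θ (batchContexts alg θ b ω) at hbad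
    push Not at hbad
    obtain ⟨b, hb, hs⟩ := hbad
    refine Set.mem_biUnion (x := b) ?_ (by_contra fun h => hs (hω b h))
    simpa using (Nat.le_div_iff_mul_le hY1).2 hb
  refine (measure_mono_ae hsub).trans ((measure_biUnion_finset_le _ _).trans ?_)
  calc _ ≤ ∑ _b ∈ Finset.range (T / Y),
        ((Y : ENNReal) + 1) * ENNReal.ofReal (1 / (2 * (T : ℝ) ^ 3)) :=
        Finset.sum_le_sum fun b _ => runLaw_lowDiversity_le I alg hd hK hKT hY θ b
    _ = ((T / Y * (Y + 1) : ℕ) : ENNReal) * ENNReal.ofReal (1 / (2 * (T : ℝ) ^ 3)) := by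
        rw [Finset.sum_const, Finset.card_range, nsmul_eq_mul]
        push_cast
        ring
    _ ≤ ((2 * T : ℕ) : ENNReal) * ENNReal.ofReal (1 / (2 * (T : ℝ) ^ 3)) := by
        -- There are `T / Y` complete batches and `Y + 1 ≤ 2Y`, so the total failure probability is
        -- at most `2T / (2T³) = T⁻²`.
        refine mul_le_mul_left (Nat.cast_le.2 ?_) _
        calc T / Y * (Y + 1) ≤ T / Y * (2 * Y) := Nat.mul_le_mul_left _ (by omega)
          _ = 2 * (T / Y * Y) := by ring
          _ ≤ 2 * T := Nat.mul_le_mul_left _ (Nat.div_mul_le_self T Y)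
    _ = _ := by
        rw [← ENNReal.ofReal_natCast, ← ENNReal.ofReal_mul (by positivity)]
        congr 1
        push_cast
        field_simp

end Simulation

end LinBandit

theorem mainTheorem7 :
    -- Diversity of every batch, conditionally on bounded perturbations and on the past.
    (∀ {d K T Y : ℕ} {S : Type*} [MeasurableSpace S], 1 ≤ d → 1 ≤ K → 4 * K ≤ T → 1 ≤ Y →
      ∀ (I : LinBandit.PerturbedContexts d K) (alg : LinBandit.BatchGreedy d K Y S)
        (θ : LinBandit.Vec d) (δ : ℝ), 0 < δ → LinBandit.Yzero d K T I.ρ δ ≤ (Y : ℝ) →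
      ∀ b : ℕ, (b + 1) * Y ≤ T →
        ∀ᵐ ω ∂(ProbabilityTheory.cond (LinBandit.runLaw I alg)
            (LinBandit.boundedPerturbations d K Y S b (LinBandit.Rhat d K T I.ρ))),
          1 - δ ≤ MeasureTheory.condExp
            (MeasurableSpace.comap (fun ω' => LinBandit.history alg θ ω' (b * Y)) inferInstance)
            (ProbabilityTheory.cond (LinBandit.runLaw I alg)
              (LinBandit.boundedPerturbations d K Y S b (LinBandit.Rhat d K T I.ρ)))
            (Set.indicator {ω' | LinBandit.Rad d K T I.ρ ^ 2 ≤
              LinBandit.lambdaMin (LinBandit.batchCovariance alg θ b ω')} fun _ => (1 : ℝ)) ω) ∧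
    -- With high probability, every batch history can simulate rewards.
    (∃ C : ℝ, 0 < C ∧ ∃ k : ℕ,
      ∀ {d K T Y : ℕ} {S : Type*} [MeasurableSpace S], 1 ≤ d → 1 ≤ K → 4 * K ≤ T → 1 ≤ Y →
      ∀ (I : LinBandit.PerturbedContexts d K),
        1 + I.ρ * √(d * Real.log (T * K * d)) ≤ LinBandit.Rad d K T I.ρ ∧
        LinBandit.Rad d K T I.ρ ≤ 1 + C * (I.ρ * √(d * Real.log (T * K * d))) ∧
        (C * Real.log (d * T) ^ k / I.ρ ^ 2 ≤ (Y : ℝ) →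
          ∀ alg : LinBandit.BatchGreedy d K Y S,
          ∃ g : ℕ → LinBandit.Vec d → (Fin Y → LinBandit.Vec d × ℝ) → ℝ,
            (∀ b x, Measurable (g b x)) ∧
            ∀ θ : LinBandit.Vec d,
              LinBandit.runLaw I alg {ω | ¬ ∀ b : ℕ, (b + 1) * Y ≤ T →
                LinBandit.SimulatesAt I alg b (LinBandit.Rad d K T I.ρ) (g b) θ
                  (LinBandit.batchContexts alg θ b ω)} ≤ ENNReal.ofReal (((T : ℝ) ^ 2)⁻¹))) := by
  refine ⟨fun {d K T Y S} _ hd hK hKT _ I alg θ δ hδ hY b _ =>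
    LinBandit.ae_cond_le_condExp_lambdaMin I alg hd hK hKT hδ hY θ b, 5000, by norm_num, 3,
    fun {d K T Y S} _ hd hK hKT _ I => ⟨LinBandit.le_Rad hd hK (by omega) I.ρ_pos,
      (LinBandit.Rad_le hd hK (by omega) I.ρ_pos).trans ?_, fun hY alg =>
      ⟨fun _ => LinBandit.simulator, fun _ => LinBandit.measurable_simulator, fun θ => ?_⟩⟩⟩
  · have := I.ρ_pos
    gcongr
    norm_num
  · obtain ⟨h1, h2⟩ := LinBandit.Yzero_le hd hK hKT I.ρ_pos I.ρ_le
    exact LinBandit.runLaw_not_simulatesAt_le I alg hd hK hKT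
      (by exact_mod_cast h2.trans_le hY) (h1.trans hY) θ
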